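/- Setting. Fix integers $p,q,N,r\ge 0$. Let $M=\mathcal S(\mathbb R^p,\mathbb R^q)$ be the space of rapidly decreasing columns $u(x)$ of $q$ functions of $x\in\mathbb R^p$, and let $\hat M_N=\mathcal S((\mathbb R^p)^{r+1},\mathbb R^{q(N+1)})$ be the space of rapidly decreasing columns $\hat\eta_N=(\eta_0^T,\dots,\eta_N^T)^T$, $\eta_j=\eta_j(y_0,\dots,y_r)\in\mathbb R^q$. Tangent and cotangent vectors at a point are elements of the same space, with duality $\langle\alpha,K\rangle=\int\alpha^TK$ (over $x$ on $M$, over $y_0,\dots,y_r$ on $\hat M_N$). Vector fields $K(u,\varepsilon)$, functionals $\tilde H(u,\varepsilon)$ and linear operators $J(u,\varepsilon):T^*(M)\to T(M)$ depend smoothly (for instance analytically in $\varepsilon$) on $u$ and on $\varepsilon$ in an open set $I\subseteq\mathbb R$ containing $0$. Here a field $K$ is called smooth if $(s,\varepsilon,x)\mapsto\chi(\varepsilon)\,(K(u_s,\varepsilon)-K(0,\varepsilon))(x)$ and $(\varepsilon,x)\mapsto\chi(\varepsilon)K(0,\varepsilon)(x)$ are Schwartz functions for every $\chi\in C_c^\infty(I)$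 and every family $u_s$ (possibly depending on $\varepsilon$) that is Schwartz in its parameters and $x$ jointly; similarly for functionals and operators. The variational derivative is defined by $\langle\frac{\delta\tilde H}{\delta u}(u),Y\rangle=\tilde H'(u)[Y]$, and $C^\infty(M)$ consists of the smooth functionals whose variational derivative exists and is a smooth cotangent field. $J$ is Hamiltonian if it is linear and skew-symmetric and $\langle\alpha,J'(u)[J(u)\beta]\gamma\rangle+\mathrm{cycle}(\alpha,\beta,\gamma)=0$ for all $u,\alpha,\beta,\gamma$ (and all $\varepsilon\in I$); $J,L$ form a Hamiltonian pair if $cJ+dL$ is Hamiltonian for all constants $c,d\in\mathbb R$; and $\{\tilde H_1,\tilde H_2\}_J=\langle\frac{\delta\tilde H_1}{\delta u},J\frac{\delta\tilde H_2}{\delta u}\rangle$. The same notions are used on $\hat M_N$. Perturbation. Put $\hat u_N=\sum_{j=0}^N\varepsilon^j\eta_j$ with $y_i=\varepsilon^ix$ (so that $\partial_x$ becomes $\sum_{i=0}^r\varepsilon^i\partial_{y_i}$). Precisely, $K(\hat u_N,\varepsilon)$ at $y=(y_0,\dots,y_r)$ is the value at $x=y_0$ of $K(\cdot,\varepsilon)$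 applied to $x\mapsto\sum_j\varepsilon^j\eta_j\big(y_0+(x-y_0),y_1+\varepsilon(x-y_0),\dots,y_r+\varepsilon^r(x-y_0)\big)$; likewise $J(\hat u_N,\varepsilon)\beta$ for a column $\beta$ of $q$ functions of $y$; and $\tilde H(\hat u_N,\varepsilon)$ is the integral over $(s_1,\dots,s_r)\in(\mathbb R^p)^r$ of $\tilde H(\cdot,\varepsilon)$ evaluated at $x\mapsto\sum_j\varepsilon^j\eta_j(x,s_1+\varepsilon x,\dots,s_r+\varepsilon^rx)$ (no integral if $r=0$). Define, with all derivatives taken at $\varepsilon=0$, $$(\mathrm{per}_NK)_i=\frac1{i!}\frac{\partial^iK(\hat u_N,\varepsilon)}{\partial\varepsilon^i},\qquad(\hat J_N)_{ij}=\frac1{(i+j-N)!}\frac{\partial^{i+j-N}J(\hat u_N,\varepsilon)}{\partial\varepsilon^{i+j-N}},\qquad \mathrm{per}_N\tilde H=\frac1{N!}\frac{\partial^N\tilde H(\hat u_N,\varepsilon)}{\partial\varepsilon^N},$$ for $0\le i,j\le N$, where $(\hat J_N)_{ij}=0$ if $i+j<N$. If $r\ge1$, all functionals of $M$ below are assumed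 to satisfy $\tilde H(0,\varepsilon)=0$ and $\frac{\delta\tilde H}{\delta u}(0,\varepsilon)=0$ for $\varepsilon\in I$. Theorem. Let $K$ be a smooth vector field on $M$ as above. (1) Suppose that $K(u,\varepsilon)=J(u,\varepsilon)\frac{\delta\tilde H}{\delta u}(u,\varepsilon)$ for all $u$ and $\varepsilon\in I$, with $J$ Hamiltonian and $\tilde H\in C^\infty(M)$. Then $\mathrm{per}_NK$, $\hat J_N$ and $\mathrm{per}_N\tilde H$ are well defined, $\hat J_N$ is a Hamiltonian operator on $\hat M_N$, $\mathrm{per}_N\tilde H\in C^\infty(\hat M_N)$, and the perturbation system $\hat\eta_{Nt}=(\mathrm{per}_NK)(\hat\eta_N)$ is Hamiltonian: $$\hat\eta_{Nt}=(\mathrm{per}_NK)(\hat\eta_N)=\hat J_N(\hat\eta_N)\frac{\delta(\mathrm{per}_N\tilde H)}{\delta\hat\eta_N}(\hat\eta_N).$$ (2) For every Hamiltonian operator $J$ and all $\tilde H_1,\tilde H_2\in C^\infty(M)$, the operator $\hat J_N$ is Hamiltonian, $\mathrm{per}_N\tilde H_1,\mathrm{per}_N\tilde H_2\in C^\infty(\hat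 M_N)$, the functional $\mathrm{per}_N\{\tilde H_1,\tilde H_2\}_J$ is well defined, and $$\{\mathrm{per}_N\tilde H_1,\mathrm{per}_N\tilde H_2\}_{\hat J_N}=\mathrm{per}_N\{\tilde H_1,\tilde H_2\}_J.$$ (3) If $K=J_1\frac{\delta\tilde H_1}{\delta u}=\dots=J_m\frac{\delta\tilde H_m}{\delta u}$ is a multi-Hamiltonian formulation, that is, each of these is a Hamiltonian formulation as in (1) and any two of $J_1,\dots,J_m$ form a Hamiltonian pair, then $$\hat\eta_{Nt}=(\mathrm{per}_NK)(\hat\eta_N)=\hat J_{1N}\frac{\delta(\mathrm{per}_N\tilde H_1)}{\delta\hat\eta_N}=\dots=\hat J_{mN}\frac{\delta(\mathrm{per}_N\tilde H_m)}{\delta\hat\eta_N}$$ is a multi-Hamiltonian formulation on $\hat M_N$ in the same sense. -/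

import Mathlib

open MeasureTheory Topology
open scoped SchwartzMap ContDiff

noncomputable section

namespace MultiScale

/-! ### Phase spaces

A phase space is a space `𝓢(X, ι → ℝ)` of rapidly decreasing column vectors of functions of the
space variable `x : X` (the time is frozen). Tangent and cotangent vectors at each point of it are
again elements of `𝓢(X, ι → ℝ)`, the duality being the integral of `αᵀ K`. -/

section General

variable {X : Type} [NormedAddCommGroup X] [NormedSpace ℝ X]
variable {ι : Type} [Fintype ι]

/-- A family of Schwartz functions, indexed by a normed space `P`, that is a Schwartz function of
the index and the variable jointly. -/
def SchwartzFamily {P : Type} [NormedAddCommGroup P] [NormedSpace ℝ P]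
    (u : P → 𝓢(X, ι → ℝ)) : Prop :=
  ∃ F : 𝓢(P × X, ι → ℝ), ∀ s x, F (s, x) = u s x

/-- Smooth cut-off functions of the perturbation parameter, compactly supported in `I`. -/
structure IsCutoff (I : Set ℝ) (χ : ℝ → ℝ) : Prop where
  smooth : ContDiff ℝ ∞ χ
  compact : HasCompactSupport χ
  support : tsupport χ ⊆ I

/-- Smooth (co)vector fields depending smoothly on the parameter `ε ∈ I`: up to its value at the
zero field, `K` carries Schwartz families to Schwartz families (jointly with `ε`). Multiplying a
family by a cut-off function of its index, one sees that this is smoothness of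
`(ε, u) ↦ K ε u` along all smooth families of fields. -/
structure IsSmoothField (I : Set ℝ) (K : ℝ → 𝓢(X, ι → ℝ) → 𝓢(X, ι → ℝ)) : Prop where
  zero : ∀ χ, IsCutoff I χ → SchwartzFamily (fun ε : ℝ => χ ε • K ε 0)
  family : ∀ (P : Type) [NormedAddCommGroup P] [NormedSpace ℝ P] [FiniteDimensional ℝ P]
    (u : P × ℝ → 𝓢(X, ι → ℝ)), SchwartzFamily u → ∀ χ, IsCutoff I χ →
      SchwartzFamily (fun s : P × ℝ => χ s.2 • (K s.2 (u s) - K s.2 0))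

/-- Smooth real functions on the phase space depending smoothly on `ε ∈ I`, in the same sense. -/
structure IsSmoothFunction (I : Set ℝ) (H : ℝ → 𝓢(X, ι → ℝ) → ℝ) : Prop where
  zero : ∀ χ, IsCutoff I χ → ContDiff ℝ ∞ (fun ε => χ ε * H ε 0)
  family : ∀ (P : Type) [NormedAddCommGroup P] [NormedSpace ℝ P] [FiniteDimensional ℝ P]
    (u : P × ℝ → 𝓢(X, ι → ℝ)), SchwartzFamily u → ∀ χ, IsCutoff I χ →
      ∃ F : 𝓢(P × ℝ, ℝ), ∀ s : P × ℝ, F s = χ s.2 * (H s.2 (u s) - H s.2 0)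

/-- Linear operators from cotangent to tangent vectors, depending smoothly on the point `u` and
on `ε ∈ I`. -/
structure IsSmoothOperator (I : Set ℝ)
    (J : ℝ → 𝓢(X, ι → ℝ) → 𝓢(X, ι → ℝ) → 𝓢(X, ι → ℝ)) : Prop where
  linear : ∀ ε ∈ I, ∀ u, IsLinearMap ℝ (J ε u)
  family : ∀ (P : Type) [NormedAddCommGroup P] [NormedSpace ℝ P] [FiniteDimensional ℝ P]
    (u α : P × ℝ → 𝓢(X, ι → ℝ)), SchwartzFamily u → SchwartzFamily α → ∀ χ, IsCutoff I χ →
      SchwartzFamily (fun s : P × ℝ => χ s.2 • J s.2 (u s) (α s))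

variable [MeasureSpace X]

/-- The duality between cotangent and tangent vectors. -/
def pairing (α K : 𝓢(X, ι → ℝ)) : ℝ := ∫ x, α x ⬝ᵥ K x

/-- `γ` is the variational derivative of `H`: `H'(u)[K] = ⟨γ(u), K⟩`. -/
def IsVarDeriv (H : 𝓢(X, ι → ℝ) → ℝ) (γ : 𝓢(X, ι → ℝ) → 𝓢(X, ι → ℝ)) : Prop :=
  ∀ u K, HasDerivAt (fun δ : ℝ => H (u + δ • K)) (pairing (γ u) K) 0

open Classical in
/-- The variational derivative (`0` if there is none). -/
def varDeriv (H : 𝓢(X, ι → ℝ) → ℝ) : 𝓢(X, ι → ℝ) → 𝓢(X, ι → ℝ) :=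
  if h : ∃ γ, IsVarDeriv H γ then h.choose else 0

/-- Smooth functionals: those whose variational derivative exists and is a (smooth) cotangent
vector field. -/
structure IsFunctional (I : Set ℝ) (H : ℝ → 𝓢(X, ι → ℝ) → ℝ) : Prop where
  smooth : IsSmoothFunction I H
  exists_varDeriv : ∀ ε ∈ I, ∃ γ, IsVarDeriv (H ε) γ
  smooth_varDeriv : IsSmoothField I (fun ε => varDeriv (H ε))

/-- The Gateaux derivative of the tensor field of an operator `J`: the number `⟨α, J'(u)[Y] γ⟩`. -/
def gateauxOp (J : 𝓢(X, ι → ℝ) → 𝓢(X, ι → ℝ) → 𝓢(X, ι → ℝ))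
    (u Y α γ : 𝓢(X, ι → ℝ)) : ℝ :=
  deriv (fun δ : ℝ => pairing α (J (u + δ • Y) γ)) 0

/-- Hamiltonian operators (for every `ε ∈ I`). -/
structure IsHamiltonianOp (I : Set ℝ)
    (J : ℝ → 𝓢(X, ι → ℝ) → 𝓢(X, ι → ℝ) → 𝓢(X, ι → ℝ)) : Prop where
  smooth : IsSmoothOperator I J
  skew : ∀ ε ∈ I, ∀ u α β, pairing α (J ε u β) + pairing β (J ε u α) = 0
  jacobi : ∀ ε ∈ I, ∀ u α β γ,
    gateauxOp (J ε) u (J ε u β) α γ + gateauxOp (J ε) u (J ε u γ) β α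
      + gateauxOp (J ε) u (J ε u α) γ β = 0

/-- Hamiltonian pairs. -/
def IsHamiltonianPair (I : Set ℝ)
    (J M : ℝ → 𝓢(X, ι → ℝ) → 𝓢(X, ι → ℝ) → 𝓢(X, ι → ℝ)) : Prop :=
  ∀ c d : ℝ, IsHamiltonianOp I (fun ε u α => c • J ε u α + d • M ε u α)

/-- The Poisson bracket of two functionals. -/
def bracket (J : 𝓢(X, ι → ℝ) → 𝓢(X, ι → ℝ) → 𝓢(X, ι → ℝ))
    (H₁ H₂ : 𝓢(X, ι → ℝ) → ℝ) (u : 𝓢(X, ι → ℝ)) : ℝ :=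
  pairing (varDeriv H₁ u) (J u (varDeriv H₂ u))

/-- `u_t = K(u, ε) = J(u, ε) δH/δu(u, ε)` is a Hamiltonian formulation of `u_t = K(u, ε)`. -/
structure IsHamiltonianFormulation (I : Set ℝ) (K : ℝ → 𝓢(X, ι → ℝ) → 𝓢(X, ι → ℝ))
    (J : ℝ → 𝓢(X, ι → ℝ) → 𝓢(X, ι → ℝ) → 𝓢(X, ι → ℝ))
    (H : ℝ → 𝓢(X, ι → ℝ) → ℝ) : Prop where
  field : IsSmoothField I K
  operator : IsHamiltonianOp I J
  functional : IsFunctional I H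
  eq : ∀ ε ∈ I, ∀ u, K ε u = J ε u (varDeriv (H ε) u)

/-- A multi-Hamiltonian formulation: finitely many Hamiltonian formulations of the same system,
any two of the Hamiltonian operators forming a Hamiltonian pair. -/
structure IsMultiHamiltonianFormulation (I : Set ℝ) (K : ℝ → 𝓢(X, ι → ℝ) → 𝓢(X, ι → ℝ))
    {m : ℕ} (J : Fin m → ℝ → 𝓢(X, ι → ℝ) → 𝓢(X, ι → ℝ) → 𝓢(X, ι → ℝ))
    (H : Fin m → ℝ → 𝓢(X, ι → ℝ) → ℝ) : Prop where
  formulation : ∀ k, IsHamiltonianFormulation I K (J k) (H k)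
  pair : ∀ k l, IsHamiltonianPair I (J k) (J l)

open Classical in
/-- The Schwartz function with the given values (`0` if there is none). -/
def toSchwartz (f : X → ι → ℝ) : 𝓢(X, ι → ℝ) :=
  if h : ∃ F : 𝓢(X, ι → ℝ), ⇑F = f then h.choose else 0

end General

/-! ### The original and the perturbed phase space -/

/-- The original space variable `x ∈ ℝᵖ`. -/
abbrev Space (p : ℕ) : Type := Fin p → ℝ

/-- The multi-scale space variables `y = (y₀, …, y_r)`, each `y_i ∈ ℝᵖ`. -/
abbrev Scales (p r : ℕ) : Type := Fin (r + 1) → Fin p → ℝ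

/-- The original phase space: columns `u` of `q` functions of `x ∈ ℝᵖ`. -/
abbrev Field (p q : ℕ) : Type := 𝓢(Space p, Fin q → ℝ)

/-- The perturbed phase space: columns `η̂_N = (η₀, …, η_N)` with `η_j` a column of `q` functions
of `y₀, …, y_r`. -/
abbrev BigField (p q N r : ℕ) : Type := 𝓢(Scales p r, Fin (N + 1) × Fin q → ℝ)

variable {p q N r : ℕ}

/-- The line in the space of scales through `y` with direction `∂_x = ∑ εⁱ ∂_{y_i}`, parametrized
by `x = y₀`; for `y = (0, q₁, …, q_r)` it is `x ↦ (x, q₁ + ε x, …, q_r + εʳ x)`. -/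
def scaleLine (ε : ℝ) (y : Scales p r) (x : Space p) : Scales p r :=
  fun i => y i + ε ^ (i : ℕ) • (x - y 0)

theorem scaleLine_hasTemperateGrowth (ε : ℝ) (y : Scales p r) :
    (scaleLine ε y).HasTemperateGrowth := by
  let L : Space p →L[ℝ] Scales p r :=
    ContinuousLinearMap.pi fun i => ε ^ (i : ℕ) • ContinuousLinearMap.id ℝ (Space p)
  have h : scaleLine ε y = fun x => L x + (fun i => y i - ε ^ (i : ℕ) • y 0) := by
    funext x i
    simp only [scaleLine, L, Pi.add_apply, ContinuousLinearMap.coe_pi',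
      _root_.smul_apply, ContinuousLinearMap.id_apply, smul_sub]
    abel
  rw [h]
  exact L.hasTemperateGrowth.add (Function.HasTemperateGrowth.const _)

theorem scaleLine_growth (ε : ℝ) (y : Scales p r) :
    ∃ (k : ℕ) (C : ℝ), ∀ x, ‖x‖ ≤ C * (1 + ‖scaleLine ε y x‖) ^ k := by
  refine ⟨1, 1, fun x => ?_⟩
  have h : scaleLine ε y x 0 = x := by simp [scaleLine]
  have h' := norm_le_pi_norm (scaleLine ε y x) 0
  rw [h] at h'
  rw [one_mul, pow_one]
  linarith

/-- The `j`-th component of a column `η̂`, restricted to the scale line through `y`, as a column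
of functions of `x`. -/
def lineComponent (ε : ℝ) (y : Scales p r) (j : Fin (N + 1)) (η : BigField p q N r) :
    Field p q :=
  SchwartzMap.postcompCLM (𝕜 := ℝ)
    (ContinuousLinearMap.pi fun a : Fin q =>
      (ContinuousLinearMap.proj (j, a) : (Fin (N + 1) × Fin q → ℝ) →L[ℝ] ℝ))
    (SchwartzMap.compCLM ℝ (scaleLine_hasTemperateGrowth ε y) (scaleLine_growth ε y) η)

theorem lineComponent_apply (ε : ℝ) (y : Scales p r) (j : Fin (N + 1)) (η : BigField p q N r)
    (x : Space p) (a : Fin q) :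
    lineComponent ε y j η x a = η (scaleLine ε y x) (j, a) := rfl

/-- The perturbation series `û_N = ∑ εʲ η_j`, as a function of `x` on the scale line through
`y`. -/
def uHat (ε : ℝ) (y : Scales p r) (η : BigField p q N r) : Field p q :=
  ∑ j : Fin (N + 1), ε ^ (j : ℕ) • lineComponent ε y j η

/-- The `k`-th Taylor coefficient at `ε = 0`. -/
def taylorCoeff (k : ℕ) (f : ℝ → ℝ) : ℝ := iteratedDeriv k f 0 / (k.factorial : ℝ)

/-- The `a`-th entry of `K(û_N, ε)` at the point `y`: `K(·, ε)` acts along the scale line through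
`y`, on which `x = y₀` at `y`. -/
def fieldAt (K : ℝ → Field p q → Field p q) (η : BigField p q N r) (y : Scales p r)
    (a : Fin q) (ε : ℝ) : ℝ :=
  K ε (uHat ε y η) (y 0) a

/-- The values of the perturbation vector field `per_N K = (K⁽⁰⁾, …, K⁽ᴺ⁾)`. -/
def perFieldVal (K : ℝ → Field p q → Field p q) (η : BigField p q N r) (y : Scales p r) :
    Fin (N + 1) × Fin q → ℝ :=
  fun ia => taylorCoeff ia.1 (fieldAt K η y ia.2)

/-- The perturbation vector field `per_N K`. -/
def perField (K : ℝ → Field p q → Field p q) (η : BigField p q N r) : BigField p q N r :=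
  toSchwartz (perFieldVal K η)

/-- The `a`-th entry of `J(û_N, ε) β_j` at the point `y`. -/
def operatorAt (J : ℝ → Field p q → Field p q → Field p q) (η β : BigField p q N r)
    (y : Scales p r) (j : Fin (N + 1)) (a : Fin q) (ε : ℝ) : ℝ :=
  J ε (uHat ε y η) (lineComponent ε y j β) (y 0) a

/-- The values of `Ĵ_N(η̂) β`: the matrix of operators `Ĵ_N` has the `(i + j - N)`-th Taylor
coefficient of `J(û_N, ε)` in position `(i, j)`, and `0` there if `i + j < N`. -/
def perOperatorVal (J : ℝ → Field p q → Field p q → Field p q) (η β : BigField p q N r)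
    (y : Scales p r) : Fin (N + 1) × Fin q → ℝ :=
  fun ia => ∑ j : Fin (N + 1),
    if N ≤ (ia.1 : ℕ) + j then taylorCoeff (ia.1 + j - N) (operatorAt J η β y j ia.2) else 0

/-- The perturbation operator `per_N J = Ĵ_N`. -/
def perOperator (J : ℝ → Field p q → Field p q → Field p q) (η β : BigField p q N r) :
    BigField p q N r :=
  toSchwartz (perOperatorVal J η β)

/-- The density of `H(û_N, ε)` transversally to the scale lines, which are labelled by
`(q₁, …, q_r)`. -/
def functionalAt (H : ℝ → Field p q → ℝ) (η : BigField p q N r) (ε : ℝ)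
    (s : Fin r → Space p) : ℝ :=
  H ε (uHat ε (Fin.cons 0 s : Scales p r) η)

/-- The perturbation functional `per_N H`: the `N`-th Taylor coefficient of `H(û_N, ε)`, where
an integral over `x` in `H` has become an integral over all the scales `y`: along the scale lines
in `H` itself, and over the lines `y₀ = x`, `y_i = q_i + εⁱ x`. For `r = 0` there is one line
only, and no integral. -/
def perFunctional (H : ℝ → Field p q → ℝ) (η : BigField p q N r) : ℝ :=
  taylorCoeff N (fun ε => ∫ s, functionalAt H η ε s)

/-- `per_N K` is a genuine vector field: the Taylor coefficients exist, and are Schwartz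
functions. -/
structure PerFieldDefined (N r : ℕ) (K : ℝ → Field p q → Field p q) : Prop where
  smooth : ∀ (η : BigField p q N r) y a, ContDiffAt ℝ ∞ (fieldAt K η y a) 0
  eq : ∀ η : BigField p q N r, ⇑(perField K η) = perFieldVal K η

/-- `per_N J` is a genuine operator on Schwartz functions. -/
structure PerOperatorDefined (N r : ℕ) (J : ℝ → Field p q → Field p q → Field p q) : Prop where
  smooth : ∀ (η β : BigField p q N r) y j a, ContDiffAt ℝ ∞ (operatorAt J η β y j a) 0
  eq : ∀ η β : BigField p q N r, ⇑(perOperator J η β) = perOperatorVal J η β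

/-- `per_N H` is a genuine functional: the integral converges and is smooth in `ε` near `0`. -/
structure PerFunctionalDefined (N r : ℕ) (H : ℝ → Field p q → ℝ) : Prop where
  integrable : ∀ η : BigField p q N r, ∀ᶠ ε in 𝓝 (0 : ℝ), Integrable (functionalAt H η ε)
  smooth : ∀ η : BigField p q N r, ContDiffAt ℝ ∞ (fun ε => ∫ s, functionalAt H η ε s) 0

/-- If there is more than one scale, `H` and its variational derivative have to vanish at the zero
field, for otherwise `H(û_N, ε)` and its gradient do not decay in the slow variables. (For
functionals without explicit `x` this is the choice of the additive constant in `H`.) -/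
def AdmitsScales (r : ℕ) (I : Set ℝ) (H : ℝ → Field p q → ℝ) : Prop :=
  0 < r → ∀ ε ∈ I, H ε 0 = 0 ∧ varDeriv (H ε) 0 = 0

end MultiScale

end

open MultiScale

/-! For fixed ε the scale lines, with direction ∑ εⁱ ∂_{y_i}, are labelled by l_i = y_i - εⁱ y₀ for
i ≥ 1, and (l, x) ↦ y is a linear measure-preserving bijection. On each line the series of a column
η, `lineSeries ε l η`, is a point of the original phase space, so `K`, `J`, `H` act line by line,
and the perturbed objects are Taylor coefficients at ε = 0 of the results.

Two algebraic facts reduce the perturbed structure to the original one. Let `rev` reverse the order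
of the components. (a) The series of `rev β` is ∑ ε^(N-j) β_j, so Ĵ_N β is the column of the
coefficients 0, …, N of J(û) applied to that series (`perOperatorVal_eq`). (b) If the column Y
consists of the coefficients 0, …, N of a family w of fields on the lines, then ⟨α, Y⟩ is the N-th
coefficient of ∫ ⟨series of `rev α`, w⟩ dl (`pairing_eq_taylorCoeff`). Hence Ĵ_N inherits
skew-symmetry, and the variational derivative of per_N H is `rev` of per_N (δH/δu)
(`isVarDeriv_perFunctional`).

Composing perturbed objects inserts a Taylor polynomial where the full family should stand. The
error is ε^(N+1) times another family (`exists_lineSeries`), and it does not reach the coefficients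
0, …, N, because operators, pairings and Gateaux derivatives are linear in the slot concerned. So
the cyclic sum for Ĵ_N is the N-th coefficient of the integral over l of the cyclic sum for J, which
is zero; the equation of motion and the bracket identity follow in the same way.

The analysis consists in keeping everything jointly Schwartz in the parameters, the labels and ε
near 0 (`IsLineFamily`, `IsLineFunction`). This permits exchanging derivatives, line integrals and
Taylor coefficients, and yields the smoothness of the perturbed objects. Values at the zero field do
not depend on the line, hence decay in the labels only if there are no labels or they vanish. -/

noncomputable section

namespace MultiScale

/-! ### Calculus of Schwartz functions -/

section Calculus

variable {E E' V V' : Type} [NormedAddCommGroup E] [NormedSpace ℝ E]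
  [NormedAddCommGroup E'] [NormedSpace ℝ E'] [NormedAddCommGroup V] [NormedSpace ℝ V]
  [NormedAddCommGroup V'] [NormedSpace ℝ V']

/-- The function `f` is a Schwartz function. -/
def IsSchwartz (f : E → V) : Prop := ∃ F : 𝓢(E, V), ⇑F = f

theorem SchwartzMap.isSchwartz (F : 𝓢(E, V)) : IsSchwartz F := ⟨F, rfl⟩

namespace IsSchwartz

variable {f g : E → V}

theorem congr (hf : IsSchwartz f) (h : ∀ x, f x = g x) : IsSchwartz g :=
  (funext h : f = g) ▸ hf

theorem contDiff (hf : IsSchwartz f) : ContDiff ℝ ∞ f := by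
  obtain ⟨F, rfl⟩ := hf
  exact F.smooth ⊤

theorem continuous (hf : IsSchwartz f) : Continuous f := hf.contDiff.continuous

theorem integrable [MeasurableSpace E] [BorelSpace E] [SecondCountableTopology E] {μ : Measure E}
    [μ.HasTemperateGrowth] (hf : IsSchwartz f) : Integrable f μ := by
  obtain ⟨F, rfl⟩ := hf
  exact F.integrable

theorem zero : IsSchwartz (fun _ : E => (0 : V)) := ⟨0, by ext; simp⟩

theorem add (hf : IsSchwartz f) (hg : IsSchwartz g) : IsSchwartz (fun x => f x + g x) := by
  obtain ⟨F, rfl⟩ := hf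
  obtain ⟨G, rfl⟩ := hg
  exact ⟨F + G, by ext; simp⟩

theorem sub (hf : IsSchwartz f) (hg : IsSchwartz g) : IsSchwartz (fun x => f x - g x) := by
  obtain ⟨F, rfl⟩ := hf
  obtain ⟨G, rfl⟩ := hg
  exact ⟨F - G, by ext; simp⟩

theorem const_smul (c : ℝ) (hf : IsSchwartz f) : IsSchwartz (fun x => c • f x) := by
  obtain ⟨F, rfl⟩ := hf
  exact ⟨c • F, by ext; simp⟩

theorem sum {κ : Type*} {f : κ → E → V} (s : Finset κ) (hf : ∀ k ∈ s, IsSchwartz (f k)) :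
    IsSchwartz (fun x => ∑ k ∈ s, f k x) := by
  classical
  induction s using Finset.induction_on with
  | empty => simpa using zero
  | insert a s ha ih =>
    simp only [Finset.sum_insert ha]
    exact (hf a (by simp)).add (ih fun k hk => hf k (by simp [hk]))

theorem postcomp (hf : IsSchwartz f) (L : V →L[ℝ] V') : IsSchwartz (fun x => L (f x)) := by
  obtain ⟨F, rfl⟩ := hf
  exact ⟨SchwartzMap.postcompCLM (𝕜 := ℝ) L F, by ext; simp⟩

theorem pi {κ : Type} [Fintype κ] {f : E → κ → ℝ} (hf : ∀ k, IsSchwartz (fun x => f x k)) :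
    IsSchwartz f := by
  classical
  have h := sum (f := fun k x => ContinuousLinearMap.single ℝ (fun _ : κ => ℝ) k (f x k))
    Finset.univ fun k _ => (hf k).postcomp (ContinuousLinearMap.single ℝ (fun _ : κ => ℝ) k)
  refine h.congr fun x => ?_
  ext k
  simp [Finset.sum_apply, Pi.single_apply]

theorem apply {κ : Type} [Fintype κ] {f : E → κ → ℝ} (hf : IsSchwartz f) (k : κ) :
    IsSchwartz (fun x => f x k) :=
  hf.postcomp (ContinuousLinearMap.proj (R := ℝ) (φ := fun _ : κ => ℝ) k)

theorem comp {f : E' → V} (hf : IsSchwartz f) {g : E → E'} (hg : g.HasTemperateGrowth)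
    (h : ∃ (k : ℕ) (C : ℝ), ∀ x, ‖x‖ ≤ C * (1 + ‖g x‖) ^ k) : IsSchwartz (fun x => f (g x)) := by
  obtain ⟨F, rfl⟩ := hf
  exact ⟨SchwartzMap.compCLM ℝ hg h F, rfl⟩

theorem comp_equiv {f : E' → V} (hf : IsSchwartz f) (L : E ≃L[ℝ] E') :
    IsSchwartz (fun x => f (L x)) := by
  obtain ⟨F, rfl⟩ := hf
  exact ⟨SchwartzMap.compCLMOfContinuousLinearEquiv ℝ L F, rfl⟩

theorem smul {c : E → ℝ} (hc : c.HasTemperateGrowth) (hf : IsSchwartz f) :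
    IsSchwartz (fun x => c x • f x) := by
  obtain ⟨F, rfl⟩ := hf
  exact ⟨SchwartzMap.smulLeftCLM V c F, by
    ext x; rw [SchwartzMap.smulLeftCLM_apply_apply hc]⟩

theorem mul {c f : E → ℝ} (hc : c.HasTemperateGrowth) (hf : IsSchwartz f) :
    IsSchwartz (fun x => c x * f x) := hf.smul hc

theorem hasTemperateGrowth (hf : IsSchwartz f) : f.HasTemperateGrowth := by
  obtain ⟨F, rfl⟩ := hf
  exact F.hasTemperateGrowth

theorem fderiv_apply (hf : IsSchwartz f) (v : E) : IsSchwartz (fun x => fderiv ℝ f x v) := by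
  obtain ⟨F, rfl⟩ := hf
  exact (SchwartzMap.isSchwartz (SchwartzMap.fderivCLM ℝ E V F)).postcomp
    (ContinuousLinearMap.apply ℝ V v)

theorem of_hasCompactSupport (h : HasCompactSupport f) (hf : ContDiff ℝ ∞ f) : IsSchwartz f :=
  ⟨h.toSchwartzMap hf, rfl⟩

theorem iteratedFDeriv_comp_fst_le {f : E → V} (hf : ContDiff ℝ ∞ f) (n : ℕ) (z : E × E') :
    ‖iteratedFDeriv ℝ n (fun z : E × E' => f z.1) z‖ ≤ ‖iteratedFDeriv ℝ n f z.1‖ := by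
  have := (ContinuousLinearMap.fst ℝ E E').iteratedFDeriv_comp_right hf z
    (i := n) (by exact_mod_cast le_top)
  change ‖iteratedFDeriv ℝ n (f ∘ ContinuousLinearMap.fst ℝ E E') z‖ ≤ _
  rw [this]
  refine (ContinuousMultilinearMap.norm_compContinuousLinearMap_le _ _).trans ?_
  refine mul_le_of_le_one_right (norm_nonneg _) ?_
  exact Finset.prod_le_one (fun _ _ => norm_nonneg _)
    fun _ _ => ContinuousLinearMap.norm_fst_le ℝ E E'

theorem iteratedFDeriv_comp_snd_le {f : E' → V} (hf : ContDiff ℝ ∞ f) (n : ℕ) (z : E × E') :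
    ‖iteratedFDeriv ℝ n (fun z : E × E' => f z.2) z‖ ≤ ‖iteratedFDeriv ℝ n f z.2‖ := by
  have := (ContinuousLinearMap.snd ℝ E E').iteratedFDeriv_comp_right hf z
    (i := n) (by exact_mod_cast le_top)
  change ‖iteratedFDeriv ℝ n (f ∘ ContinuousLinearMap.snd ℝ E E') z‖ ≤ _
  rw [this]
  refine (ContinuousMultilinearMap.norm_compContinuousLinearMap_le _ _).trans ?_
  refine mul_le_of_le_one_right (norm_nonneg _) ?_
  exact Finset.prod_le_one (fun _ _ => norm_nonneg _)
    fun _ _ => ContinuousLinearMap.norm_snd_le ℝ E E'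

/-- The tensor product of two Schwartz functions. -/
theorem tensor {f : E → ℝ} {g : E' → ℝ} (hf : IsSchwartz f) (hg : IsSchwartz g) :
    IsSchwartz (fun z : E × E' => f z.1 * g z.2) := by
  obtain ⟨F, rfl⟩ := hf
  obtain ⟨G, rfl⟩ := hg
  have hF : ContDiff ℝ ∞ (fun z : E × E' => F z.1) := (F.smooth ⊤).comp contDiff_fst
  have hG : ContDiff ℝ ∞ (fun z : E × E' => G z.2) := (G.smooth ⊤).comp contDiff_snd
  refine ⟨⟨fun z => F z.1 * G z.2, hF.mul hG, fun k n => ?_⟩, rfl⟩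
  let A := (Finset.Iic (k, n)).sup (schwartzSeminormFamily ℝ E ℝ) F
  let B := (Finset.Iic (k, n)).sup (schwartzSeminormFamily ℝ E' ℝ) G
  refine ⟨∑ i ∈ Finset.range (n + 1), (n.choose i : ℝ) * (2 ^ k * A) * (2 ^ k * B), fun z => ?_⟩
  have hz : ‖z‖ ^ k ≤ (1 + ‖z.1‖) ^ k * (1 + ‖z.2‖) ^ k := by
    rw [← mul_pow]
    refine pow_le_pow_left₀ (norm_nonneg _) ?_ k
    have h1 := norm_nonneg z.1
    have h2 := norm_nonneg z.2
    refine (max_le ?_ ?_ : ‖z‖ ≤ _) <;> nlinarith [mul_nonneg h1 h2]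
  have hmul := norm_iteratedFDeriv_mul_le hF hG z (n := n) (by exact_mod_cast le_top)
  calc ‖z‖ ^ k * ‖iteratedFDeriv ℝ n (fun z : E × E' => F z.1 * G z.2) z‖
      ≤ ((1 + ‖z.1‖) ^ k * (1 + ‖z.2‖) ^ k) * ∑ i ∈ Finset.range (n + 1), (n.choose i : ℝ) *
          ‖iteratedFDeriv ℝ i (fun z : E × E' => F z.1) z‖ *
          ‖iteratedFDeriv ℝ (n - i) (fun z : E × E' => G z.2) z‖ := by gcongr
    _ ≤ _ := by
      rw [Finset.mul_sum]
      refine Finset.sum_le_sum fun i hi => ?_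
      have hi' : i ≤ n := Nat.lt_succ_iff.1 (Finset.mem_range.1 hi)
      have h1 : (1 + ‖z.1‖) ^ k * ‖iteratedFDeriv ℝ i (fun z : E × E' => F z.1) z‖
          ≤ 2 ^ k * A :=
        (mul_le_mul_of_nonneg_left (iteratedFDeriv_comp_fst_le (F.smooth ⊤) i z)
          (by positivity)).trans
          (SchwartzMap.one_add_le_sup_seminorm_apply (𝕜 := ℝ) (m := (k, n)) le_rfl hi' F z.1)
      have h2 : (1 + ‖z.2‖) ^ k * ‖iteratedFDeriv ℝ (n - i) (fun z : E × E' => G z.2) z‖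
          ≤ 2 ^ k * B :=
        (mul_le_mul_of_nonneg_left (iteratedFDeriv_comp_snd_le (G.smooth ⊤) (n - i) z)
          (by positivity)).trans
          (SchwartzMap.one_add_le_sup_seminorm_apply (𝕜 := ℝ) (m := (k, n)) le_rfl
            (Nat.sub_le n i) G z.2)
      calc _ = (n.choose i : ℝ) *
            ((1 + ‖z.1‖) ^ k * ‖iteratedFDeriv ℝ i (fun z : E × E' => F z.1) z‖) *
            ((1 + ‖z.2‖) ^ k * ‖iteratedFDeriv ℝ (n - i) (fun z : E × E' => G z.2) z‖) := by ring
        _ ≤ _ := by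
          have : 0 ≤ 2 ^ k * A := le_trans (by positivity) h1
          gcongr

/-! ### Integrals of Schwartz functions over some of the variables. -/

section Integral

variable {Z : Type} [NormedAddCommGroup Z] [NormedSpace ℝ Z] [MeasurableSpace Z] [BorelSpace Z]
  [SecondCountableTopology Z] (μ : Measure Z) [μ.HasTemperateGrowth]

theorem slice_integrable (F : 𝓢(E × Z, V)) (e : E) : Integrable (fun z => F (e, z)) μ := by
  have h := integrable_of_le_of_pow_mul_le (μ := μ) (f := fun z => F (e, z)) (k := 0)
    (C₁ := SchwartzMap.seminorm ℝ 0 0 F)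
    (C₂ := SchwartzMap.seminorm ℝ μ.integrablePower 0 F)
    (fun z => F.norm_le_seminorm ℝ (e, z))
    (fun z => by
      rw [zero_add]
      refine le_trans ?_ (F.norm_pow_mul_le_seminorm ℝ μ.integrablePower (e, z))
      gcongr
      exact le_max_right _ _)
    (by fun_prop)
  simp only [pow_zero, one_mul] at h
  exact (integrable_norm_iff (by fun_prop)).1 h

omit [BorelSpace Z] [SecondCountableTopology Z] in
-- The norm of a pair dominates the norms of both entries, so decay of `F` in the joint norm pays
-- both for the weight in `e` and for integrability in `z`.
theorem norm_pow_mul_integral_le (F : 𝓢(E × Z, V)) (k : ℕ) :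
    ∃ C : ℝ, ∀ e, ‖e‖ ^ k * ‖∫ z, F (e, z) ∂μ‖ ≤ C := by
  refine ⟨2 ^ μ.integrablePower * (∫ z, (1 + ‖z‖) ^ (-(μ.integrablePower : ℝ)) ∂μ) *
    (SchwartzMap.seminorm ℝ k 0 F + SchwartzMap.seminorm ℝ (μ.integrablePower + k) 0 F),
    fun e => ?_⟩
  have h := integral_pow_mul_le_of_le_of_pow_mul_le (μ := μ)
    (f := fun z => ‖e‖ ^ k • F (e, z)) (k := 0)
    (C₁ := SchwartzMap.seminorm ℝ k 0 F)
    (C₂ := SchwartzMap.seminorm ℝ (μ.integrablePower + k) 0 F)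
    (fun z => by
      rw [norm_smul, norm_pow, norm_norm]
      refine le_trans ?_ (F.norm_pow_mul_le_seminorm ℝ k (e, z))
      gcongr
      exact le_max_left _ _)
    (fun z => by
      rw [norm_smul, norm_pow, norm_norm, zero_add, ← mul_assoc]
      refine le_trans ?_ (F.norm_pow_mul_le_seminorm ℝ (μ.integrablePower + k) (e, z))
      rw [pow_add]
      gcongr
      · exact le_max_right _ _
      · exact le_max_left _ _)
  refine le_trans ?_ h
  simp only [pow_zero, one_mul]
  calc ‖e‖ ^ k * ‖∫ z, F (e, z) ∂μ‖ = ‖∫ z, ‖e‖ ^ k • F (e, z) ∂μ‖ := by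
        rw [integral_smul, norm_smul, norm_pow, norm_norm]
    _ ≤ _ := norm_integral_le_integral_norm _

theorem hasFDerivAt_integral [CompleteSpace V] (F : 𝓢(E × Z, V)) (e : E) :
    HasFDerivAt (fun e => ∫ z, F (e, z) ∂μ)
      (∫ z, (fderiv ℝ F (e, z)).comp (ContinuousLinearMap.inl ℝ E Z) ∂μ) e := by
  let G : 𝓢(E × Z, E →L[ℝ] V) := SchwartzMap.postcompCLM (𝕜 := ℝ)
    ((ContinuousLinearMap.compL ℝ E (E × Z) V).flip (ContinuousLinearMap.inl ℝ E Z))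
    (SchwartzMap.fderivCLM ℝ (E × Z) V F)
  have hG : ∀ w, G w = (fderiv ℝ F w).comp (ContinuousLinearMap.inl ℝ E Z) := fun w => rfl
  refine hasFDerivAt_integral_of_dominated_of_fderiv_le (s := Set.univ)
    (F := fun e z => F (e, z))
    (F' := fun e z => (fderiv ℝ F (e, z)).comp (ContinuousLinearMap.inl ℝ E Z))
    (bound := fun z => 2 ^ μ.integrablePower * (SchwartzMap.seminorm ℝ 0 0 G +
      SchwartzMap.seminorm ℝ μ.integrablePower 0 G) * (1 + ‖z‖) ^ (-(μ.integrablePower : ℝ)))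
    Filter.univ_mem ?_ (slice_integrable μ F e) ?_ ?_ ?_ ?_
  · exact Filter.Eventually.of_forall fun e => (slice_integrable μ F e).aestronglyMeasurable
  · exact (slice_integrable μ G e).aestronglyMeasurable
  · refine Filter.Eventually.of_forall fun z e _ => ?_
    have := pow_mul_le_of_le_of_pow_mul_le (k := 0) (l := μ.integrablePower) (norm_nonneg z)
      (norm_nonneg (G (e, z))) (G.norm_le_seminorm ℝ (e, z))
      (C₂ := SchwartzMap.seminorm ℝ μ.integrablePower 0 G) (by
        rw [zero_add]
        refine le_trans ?_ (G.norm_pow_mul_le_seminorm ℝ μ.integrablePower (e, z))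
        gcongr
        exact le_max_right _ _)
    simpa [hG] using this
  · exact (Measure.integrable_pow_neg_integrablePower μ).const_mul _
  · refine Filter.Eventually.of_forall fun z e _ => ?_
    exact (F.hasFDerivAt (e, z)).comp e ((hasFDerivAt_id e).prodMk (hasFDerivAt_const z e))

/-- The derivative of the integral is again such an integral, of a Schwartz function with values in
`E →L[ℝ] V`; therefore the induction on `n` has to run over all target spaces at once. -/
theorem contDiff_integral_and_decay (n : ℕ) : ∀ {V : Type} [NormedAddCommGroup V]
    [NormedSpace ℝ V] [CompleteSpace V] (F : 𝓢(E × Z, V)),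
    ContDiff ℝ n (fun e => ∫ z, F (e, z) ∂μ) ∧ ∀ k : ℕ, ∃ C : ℝ, ∀ e,
      ‖e‖ ^ k * ‖iteratedFDeriv ℝ n (fun e => ∫ z, F (e, z) ∂μ) e‖ ≤ C := by
  induction n with
  | zero =>
    intro V _ _ _ F
    refine ⟨?_, fun k => ?_⟩
    · exact contDiff_zero.2 (continuous_iff_continuousAt.2 fun e =>
        (hasFDerivAt_integral μ F e).continuousAt)
    · simpa only [norm_iteratedFDeriv_zero] using norm_pow_mul_integral_le μ F k
  | succ n ih =>
    intro V _ _ _ F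
    let G : 𝓢(E × Z, E →L[ℝ] V) := SchwartzMap.postcompCLM (𝕜 := ℝ)
      ((ContinuousLinearMap.compL ℝ E (E × Z) V).flip (ContinuousLinearMap.inl ℝ E Z))
      (SchwartzMap.fderivCLM ℝ (E × Z) V F)
    have hG : fderiv ℝ (fun e => ∫ z, F (e, z) ∂μ) = fun e => ∫ z, G (e, z) ∂μ :=
      funext fun e => (hasFDerivAt_integral μ F e).fderiv
    obtain ⟨h1, h2⟩ := ih G
    refine ⟨?_, fun k => ?_⟩
    · push_cast
      refine contDiff_succ_iff_fderiv.2 ⟨fun e => (hasFDerivAt_integral μ F e).differentiableAt,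
        by simp, ?_⟩
      rw [hG]
      exact h1
    · simp only [← norm_iteratedFDeriv_fderiv, hG]
      exact h2 k

/-- Integrating a Schwartz function over some of its variables yields a Schwartz function of the
remaining ones. -/
theorem integral [CompleteSpace V] {f : E × Z → V} (hf : IsSchwartz f) :
    IsSchwartz (fun e => ∫ z, f (e, z) ∂μ) := by
  obtain ⟨F, rfl⟩ := hf
  exact ⟨⟨fun e => ∫ z, F (e, z) ∂μ,
    contDiff_infty.2 fun n => (contDiff_integral_and_decay μ n F).1,
    fun k n => (contDiff_integral_and_decay μ n F).2 k⟩, rfl⟩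

end Integral

/-! Derivatives and Taylor coefficients in a real parameter. -/

theorem hasDerivAt_snd {f : E × ℝ → V} (hf : IsSchwartz f) (a : E) (ε : ℝ) :
    HasDerivAt (fun t => f (a, t)) (fderiv ℝ f (a, ε) (0, 1)) ε := by
  have h1 : HasFDerivAt f (fderiv ℝ f (a, ε)) (a, ε) :=
    ((hf.contDiff.differentiable (by simp)) (a, ε)).hasFDerivAt
  have h2 : HasDerivAt (fun t : ℝ => (a, t)) (0, 1) ε :=
    (hasDerivAt_const ε a).prodMk (hasDerivAt_id ε)
  exact h1.comp_hasDerivAt ε h2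

theorem deriv_snd {f : E × ℝ → V} (hf : IsSchwartz f) :
    IsSchwartz (fun z : E × ℝ => deriv (fun t => f (z.1, t)) z.2) :=
  (hf.fderiv_apply (0, 1)).congr fun z => (hf.hasDerivAt_snd z.1 z.2).deriv.symm

theorem iteratedDeriv_snd {f : E × ℝ → V} (hf : IsSchwartz f) (k : ℕ) :
    IsSchwartz (fun z : E × ℝ => iteratedDeriv k (fun t => f (z.1, t)) z.2) := by
  induction k with
  | zero => simpa only [iteratedDeriv_zero] using hf
  | succ k ih => simpa only [iteratedDeriv_succ] using ih.deriv_snd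

theorem slice_snd {f : E × E' → V} (hf : IsSchwartz f) (b : E') :
    IsSchwartz (fun a : E => f (a, b)) := by
  refine hf.comp (g := fun a : E => (a, b)) ?_ ⟨1, 1, fun x => ?_⟩
  · have h : (fun a : E => (a, b)) = fun a => ContinuousLinearMap.inl ℝ E E' a + (0, b) := by
      ext a <;> simp
    rw [h]
    fun_prop
  · have : ‖x‖ ≤ ‖(x, b)‖ := le_max_left _ _
    simp only [pow_one, one_mul]
    linarith

theorem contDiff_slice {f : E × E' → V} (hf : IsSchwartz f) (a : E) :
    ContDiff ℝ ∞ (fun b => f (a, b)) :=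
  hf.contDiff.comp (contDiff_const.prodMk contDiff_id)

theorem taylorCoeff {f : E × ℝ → ℝ} (hf : IsSchwartz f) (k : ℕ) :
    IsSchwartz (fun a => MultiScale.taylorCoeff k (fun ε => f (a, ε))) := by
  have := ((hf.iteratedDeriv_snd k).slice_snd 0).const_smul ((k.factorial : ℝ)⁻¹)
  refine this.congr fun a => ?_
  simp only [MultiScale.taylorCoeff, smul_eq_mul]
  ring

theorem integral_iteratedDeriv {Z : Type} [NormedAddCommGroup Z] [NormedSpace ℝ Z]
    [MeasurableSpace Z] [BorelSpace Z] [SecondCountableTopology Z] (μ : Measure Z)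
    [μ.HasTemperateGrowth] {f : Z × ℝ → ℝ} (hf : IsSchwartz f) (k : ℕ) (ε : ℝ) :
    iteratedDeriv k (fun ε => ∫ z, f (z, ε) ∂μ) ε
      = ∫ z, iteratedDeriv k (fun t => f (z, t)) ε ∂μ := by
  induction k generalizing ε with
  | zero => simp
  | succ k ih =>
    have h : iteratedDeriv k (fun ε => ∫ z, f (z, ε) ∂μ) =
      fun ε => ∫ z, iteratedDeriv k (fun t => f (z, t)) ε ∂μ := funext ih
    have hk := hf.iteratedDeriv_snd k
    -- Differentiation under the integral is available with the parameter as the first variable, so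
    -- the two variables are exchanged.
    have hk' := hk.comp_equiv (ContinuousLinearEquiv.prodComm ℝ ℝ Z)
    obtain ⟨F, hF⟩ := hk'
    have hd := (hasFDerivAt_integral μ F ε).hasDerivAt.deriv
    have hF' : ∀ (ε : ℝ) (z : Z), F (ε, z) = iteratedDeriv k (fun t => f (z, t)) ε :=
      fun ε z => congrFun hF (ε, z)
    rw [iteratedDeriv_succ, h]
    simp only [hF'] at hd
    rw [hd]
    have hint : Integrable (fun z => (fderiv ℝ F (ε, z)).comp (ContinuousLinearMap.inl ℝ ℝ Z)) μ :=
      slice_integrable μ (SchwartzMap.postcompCLM (𝕜 := ℝ)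
        ((ContinuousLinearMap.compL ℝ ℝ (ℝ × Z) ℝ).flip (ContinuousLinearMap.inl ℝ ℝ Z))
        (SchwartzMap.fderivCLM ℝ (ℝ × Z) ℝ F)) ε
    rw [ContinuousLinearMap.integral_apply hint]
    refine integral_congr_ae (Filter.Eventually.of_forall fun z => ?_)
    have h1 : HasDerivAt (fun t : ℝ => F (t, z)) (fderiv ℝ F (ε, z) (1, 0)) ε :=
      (F.hasFDerivAt (ε, z)).comp_hasDerivAt ε
        ((hasDerivAt_id ε).prodMk (hasDerivAt_const ε z))
    simp only [hF'] at h1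
    simp only [iteratedDeriv_succ]
    rw [h1.deriv]
    simp

theorem taylorCoeff_integral {Z : Type} [NormedAddCommGroup Z] [NormedSpace ℝ Z]
    [MeasurableSpace Z] [BorelSpace Z] [SecondCountableTopology Z] (μ : Measure Z)
    [μ.HasTemperateGrowth] {f : Z × ℝ → ℝ} (hf : IsSchwartz f) (k : ℕ) :
    MultiScale.taylorCoeff k (fun ε => ∫ z, f (z, ε) ∂μ)
      = ∫ z, MultiScale.taylorCoeff k (fun t => f (z, t)) ∂μ := by
  simp only [MultiScale.taylorCoeff, hf.integral_iteratedDeriv μ k 0, integral_div]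

end IsSchwartz

/-! ### Temperate growth, cut-offs, division by the parameter. -/

@[fun_prop]
theorem _root_.Function.HasTemperateGrowth.prodMk {f : E → V} {g : E → V'}
    (hf : f.HasTemperateGrowth) (hg : g.HasTemperateGrowth) :
    (fun x => (f x, g x)).HasTemperateGrowth := by
  have h : (fun x => (f x, g x)) = fun x => ContinuousLinearMap.inl ℝ V V' (f x) +
      ContinuousLinearMap.inr ℝ V V' (g x) := by
    ext x <;> simp
  rw [h]
  fun_prop

@[fun_prop]
theorem _root_.Function.HasTemperateGrowth.fst {f : E → V × V'} (hf : f.HasTemperateGrowth) :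
    (fun x => (f x).1).HasTemperateGrowth :=
  (ContinuousLinearMap.fst ℝ V V').hasTemperateGrowth.comp hf

@[fun_prop]
theorem _root_.Function.HasTemperateGrowth.snd {f : E → V × V'} (hf : f.HasTemperateGrowth) :
    (fun x => (f x).2).HasTemperateGrowth :=
  (ContinuousLinearMap.snd ℝ V V').hasTemperateGrowth.comp hf

theorem _root_.Function.HasTemperateGrowth.pi {κ : Type} [Fintype κ] {f : E → κ → V}
    (hf : ∀ k, (fun x => f x k).HasTemperateGrowth) : f.HasTemperateGrowth := by
  classical
  have h : f = fun x => ∑ k, ContinuousLinearMap.single ℝ (fun _ : κ => V) k (f x k) := by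
    ext x k
    simp
  rw [h]
  exact Function.HasTemperateGrowth.sum fun k _ =>
    (ContinuousLinearMap.hasTemperateGrowth _).comp (hf k)

theorem exists_cutoff {I : Set ℝ} (hI : IsOpen I) {ε₀ : ℝ} (h0 : ε₀ ∈ I) :
    ∃ χ, IsCutoff I χ ∧ ∀ᶠ ε in 𝓝 ε₀, χ ε = 1 := by
  obtain ⟨δ, hδ, hsub⟩ := Metric.nhds_basis_closedBall.mem_iff.1 (hI.mem_nhds h0)
  let b : ContDiffBump ε₀ := ⟨δ / 2, δ, by positivity, by linarith⟩
  exact ⟨b, ⟨b.contDiff, b.hasCompactSupport, b.tsupport_eq.trans_subset hsub⟩, b.eventuallyEq_one⟩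

theorem IsCutoff.isSchwartz {I : Set ℝ} {χ : ℝ → ℝ} (h : IsCutoff I χ) : IsSchwartz χ :=
  IsSchwartz.of_hasCompactSupport h.compact h.smooth

/-- Division of a Schwartz function by a variable at whose zero it vanishes. -/
theorem IsSchwartz.exists_eq_mul {f : E × ℝ → ℝ} (hf : IsSchwartz f) (h0 : ∀ a, f (a, 0) = 0) :
    ∃ R : E × ℝ → ℝ, IsSchwartz R ∧ ∀ a, ∀ ε : ℝ, |ε| ≤ 1 → f (a, ε) = ε * R (a, ε) := by
  -- Hadamard's formula: f(a, ε) = ε ∫₀¹ ∂f(a, tε) dt. The integrand need not decay in ε at t = 0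
  -- nor in t at ε = 0, so it is multiplied by θ(ε) θ(t), which is 1 for |ε|, |t| ≤ 1. This is why
  -- the factorization is claimed only for |ε| ≤ 1.
  let θ : ContDiffBump (0 : ℝ) := ⟨1, 2, one_pos, one_lt_two⟩
  have hθ : IsSchwartz θ := .of_hasCompactSupport θ.hasCompactSupport θ.contDiff
  have hθ1 : ∀ t : ℝ, |t| ≤ 1 → θ t = 1 := fun t ht =>
    θ.one_of_mem_closedBall (by simpa using ht)
  have hg : IsSchwartz (fun z : (E × ℝ) × ℝ =>
      fderiv ℝ f (z.1.1, z.2 * z.1.2) (0, 1) * (θ z.1.2 * θ z.2)) := by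
    have h1 := ((hf.fderiv_apply (0, 1)).tensor (hθ.tensor hθ)).comp
      (g := fun z : (E × ℝ) × ℝ => ((z.1.1, z.2 * z.1.2), (z.1.2, z.2))) ?_ ⟨1, 1, fun z => ?_⟩
    · exact h1
    · have h11 : (fun z : (E × ℝ) × ℝ => z.1.1).HasTemperateGrowth :=
        ((ContinuousLinearMap.fst ℝ E ℝ).comp
          (ContinuousLinearMap.fst ℝ (E × ℝ) ℝ)).hasTemperateGrowth
      have h12 : (fun z : (E × ℝ) × ℝ => z.1.2).HasTemperateGrowth :=
        ((ContinuousLinearMap.snd ℝ E ℝ).comp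
          (ContinuousLinearMap.fst ℝ (E × ℝ) ℝ)).hasTemperateGrowth
      have h2 : (fun z : (E × ℝ) × ℝ => z.2).HasTemperateGrowth :=
        (ContinuousLinearMap.snd ℝ (E × ℝ) ℝ).hasTemperateGrowth
      exact (h11.prodMk (h2.mul h12)).prodMk (h12.prodMk h2)
    · simp only [Prod.norm_def, pow_one, one_mul]
      refine le_trans ?_ (le_add_of_nonneg_left zero_le_one)
      refine max_le (max_le ?_ ?_) ?_ <;> simp
  refine ⟨_, hg.integral (volume.restrict (Set.Ioc (0 : ℝ) 1)), fun a ε hε => ?_⟩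
  have hft : ∫ t in (0 : ℝ)..1, fderiv ℝ f (a, t * ε) (0, 1) * ε = f (a, ε) := by
    rw [intervalIntegral.integral_eq_sub_of_hasDerivAt (f := fun t => f (a, t * ε))]
    · simp [h0]
    · intro t _
      have h2 : HasDerivAt (fun t : ℝ => t * ε) ε t := by simpa using (hasDerivAt_id t).mul_const ε
      exact (hf.hasDerivAt_snd a (t * ε)).comp t h2
    · refine Continuous.intervalIntegrable ?_ _ _
      have := (hf.fderiv_apply (0, 1)).continuous
      fun_prop
  rw [intervalIntegral.integral_of_le zero_le_one] at hft
  rw [← hft, ← integral_const_mul]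
  refine setIntegral_congr_fun measurableSet_Ioc fun t ht => ?_
  have ht' : |t| ≤ 1 := abs_le.2 ⟨by linarith [ht.1], ht.2⟩
  simp only [hθ1 t ht', hθ1 ε hε]
  ring

end Calculus

/-! ### Taylor coefficients -/

section Taylor

variable {f g : ℝ → ℝ} {k m : ℕ}

theorem taylorCoeff_congr (h : f =ᶠ[𝓝 0] g) (k : ℕ) : taylorCoeff k f = taylorCoeff k g := by
  rw [taylorCoeff, taylorCoeff, h.iteratedDeriv_eq k]

theorem taylorCoeff_add (hf : ContDiffAt ℝ ∞ f 0) (hg : ContDiffAt ℝ ∞ g 0) (k : ℕ) :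
    taylorCoeff k (fun ε => f ε + g ε) = taylorCoeff k f + taylorCoeff k g := by
  have hk : (k : WithTop ℕ∞) ≤ ∞ := by exact_mod_cast le_top
  rw [taylorCoeff, iteratedDeriv_fun_add (hf.of_le hk) (hg.of_le hk), add_div]
  rfl

theorem taylorCoeff_sub (hf : ContDiffAt ℝ ∞ f 0) (hg : ContDiffAt ℝ ∞ g 0) (k : ℕ) :
    taylorCoeff k (fun ε => f ε - g ε) = taylorCoeff k f - taylorCoeff k g := by
  have hk : (k : WithTop ℕ∞) ≤ ∞ := by exact_mod_cast le_top
  rw [taylorCoeff, iteratedDeriv_fun_sub (hf.of_le hk) (hg.of_le hk), sub_div]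
  rfl

theorem taylorCoeff_const_mul (c : ℝ) (f : ℝ → ℝ) (k : ℕ) :
    taylorCoeff k (fun ε => c * f ε) = c * taylorCoeff k f := by
  simp [taylorCoeff, iteratedDeriv_const_mul_field, mul_div_assoc]

theorem taylorCoeff_zero_fun (k : ℕ) : taylorCoeff k (fun _ => 0) = 0 := by
  have := taylorCoeff_const_mul 0 (fun _ => 0) k
  simpa using this

theorem taylorCoeff_sum {κ : Type*} (s : Finset κ) {f : κ → ℝ → ℝ}
    (hf : ∀ j ∈ s, ContDiffAt ℝ ∞ (f j) 0) (k : ℕ) :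
    taylorCoeff k (fun ε => ∑ j ∈ s, f j ε) = ∑ j ∈ s, taylorCoeff k (f j) := by
  classical
  induction s using Finset.induction_on with
  | empty => simp [taylorCoeff_zero_fun]
  | insert a s ha ih =>
    simp only [Finset.sum_insert ha]
    rw [taylorCoeff_add (hf a (by simp)) (ContDiffAt.sum fun j hj => hf j (by simp [hj])),
      ih fun j hj => hf j (by simp [hj])]

/-- In the Leibniz formula at 0 only the m-th derivative of ε^m survives. This index shift produces
the shifts in Ĵ_N and makes remainders of order N + 1 disappear. -/
theorem taylorCoeff_pow_mul (m : ℕ) (hf : ContDiffAt ℝ ∞ f 0) (k : ℕ) :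
    taylorCoeff k (fun ε => ε ^ m * f ε) = if m ≤ k then taylorCoeff (k - m) f else 0 := by
  have hk : (k : WithTop ℕ∞) ≤ ∞ := by exact_mod_cast le_top
  rw [taylorCoeff, iteratedDeriv_fun_mul (by fun_prop) (hf.of_le hk)]
  simp only [iteratedDeriv_fun_pow_zero]
  split_ifs with h
  · rw [Finset.sum_eq_single m]
    · have h1 : (k.choose m : ℝ) * (m.factorial : ℝ) * ((k - m).factorial : ℝ) = k.factorial := by
        exact_mod_cast Nat.choose_mul_factorial_mul_factorial h
      have h2 : ((k - m).factorial : ℝ) ≠ 0 := by positivity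
      have h3 : (k.factorial : ℝ) ≠ 0 := by positivity
      rw [taylorCoeff, div_eq_div_iff h3 h2]
      simp only [if_true]
      rw [← h1]
      ring
    · intro b _ hb
      simp [hb]
    · intro hm
      exact absurd (Finset.mem_range.2 (Nat.lt_succ_of_le h)) hm
  · rw [Finset.sum_eq_zero, zero_div]
    intro b hb
    have : b ≠ m := by
      rintro rfl
      exact h (Nat.lt_succ_iff.1 (Finset.mem_range.1 hb))
    simp [this]

theorem taylorCoeff_polynomial (N : ℕ) (c : Fin (N + 1) → ℝ) (k : Fin (N + 1)) :
    taylorCoeff k (fun ε => ∑ j : Fin (N + 1), ε ^ (j : ℕ) * c j) = c k := by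
  rw [taylorCoeff_sum _ (fun j _ => by fun_prop)]
  rw [Finset.sum_eq_single k]
  · rw [taylorCoeff_pow_mul _ contDiffAt_const]
    simp [taylorCoeff]
  · intro j _ hj
    rw [taylorCoeff_pow_mul _ contDiffAt_const]
    split_ifs with h
    · have h' : (j : ℕ) ≠ k := fun h' => hj (Fin.ext h')
      have h'' : (k : ℕ) - j ≠ 0 := by omega
      simp [taylorCoeff, iteratedDeriv_const, h'']
    · rfl
  · simp

end Taylor

variable {E : Type} [NormedAddCommGroup E] [NormedSpace ℝ E]

/-- Taylor's theorem for Schwartz functions. -/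
theorem IsSchwartz.exists_eq_pow_mul (m : ℕ) : ∀ {f : E × ℝ → ℝ}, IsSchwartz f →
    (∀ k < m, ∀ a, MultiScale.taylorCoeff k (fun ε => f (a, ε)) = 0) →
    ∃ R : E × ℝ → ℝ, IsSchwartz R ∧ ∀ a, ∀ ε : ℝ, |ε| ≤ 1 → f (a, ε) = ε ^ m * R (a, ε) := by
  induction m with
  | zero => exact fun {f} hf _ => ⟨f, hf, by simp⟩
  | succ m ih =>
    intro f hf h
    obtain ⟨R, hR, hfR⟩ := hf.exists_eq_mul fun a => by
      simpa [MultiScale.taylorCoeff] using h 0 (Nat.succ_pos m) a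
    obtain ⟨S, hS, hRS⟩ := ih hR fun k hk a => by
      have h1 := h (k + 1) (Nat.succ_lt_succ hk) a
      -- The coefficient k of the quotient is the coefficient k + 1 of `f`, so the quotient
      -- satisfies the induction hypothesis.
      have h2 : (fun ε => f (a, ε)) =ᶠ[𝓝 0] fun ε => ε ^ 1 * R (a, ε) := by
        filter_upwards [Metric.closedBall_mem_nhds (0 : ℝ) one_pos] with ε hε
        rw [pow_one]
        exact hfR a ε (by simpa using hε)
      rw [taylorCoeff_congr h2, taylorCoeff_pow_mul 1 (hR.contDiff_slice a).contDiffAt] at h1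
      simpa using h1
    exact ⟨S, hS, fun a ε hε => by rw [hfR a ε hε, hRS a ε hε]; ring⟩

/-- Symmetry of the second Fréchet derivative, in terms of one-variable derivatives, from which
Taylor coefficients are built. -/
theorem IsSchwartz.deriv_deriv_comm {f : ℝ × ℝ → ℝ} (hf : IsSchwartz f) (δ ε : ℝ) :
    deriv (fun s => deriv (fun t => f (s, t)) ε) δ
      = deriv (fun t => deriv (fun s => f (s, t)) δ) ε := by
  have hd : ∀ z, HasFDerivAt f (fderiv ℝ f z) z := fun z =>
    ((hf.contDiff.differentiable (by simp)) z).hasFDerivAt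
  have hd2 : ∀ z, HasFDerivAt (fderiv ℝ f) (fderiv ℝ (fderiv ℝ f) z) z := fun z =>
    ((hf.contDiff.fderiv_right (m := ∞) (by simp)).differentiable (by simp) z).hasFDerivAt
  have hl : ∀ s t : ℝ, HasDerivAt (fun s : ℝ => (s, t)) ((1, 0) : ℝ × ℝ) s := fun s t =>
    (hasDerivAt_id s).prodMk (hasDerivAt_const s t)
  have hr : ∀ s t : ℝ, HasDerivAt (fun t : ℝ => (s, t)) ((0, 1) : ℝ × ℝ) t := fun s t =>
    (hasDerivAt_const t s).prodMk (hasDerivAt_id t)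
  have h1 : ∀ s t, deriv (fun t => f (s, t)) t = fderiv ℝ f (s, t) (0, 1) := fun s t =>
    ((hd (s, t)).comp_hasDerivAt t (hr s t)).deriv
  have h2 : ∀ s t, deriv (fun s => f (s, t)) s = fderiv ℝ f (s, t) (1, 0) := fun s t =>
    ((hd (s, t)).comp_hasDerivAt s (hl s t)).deriv
  have hs : IsSymmSndFDerivAt ℝ f (δ, ε) :=
    hf.contDiff.contDiffAt.isSymmSndFDerivAt (by
      rw [minSmoothness_of_isRCLikeNormedField]
      exact WithTop.coe_le_coe.2 (le_top : (2 : ℕ∞) ≤ ⊤))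
  have h3 : HasDerivAt (fun s => fderiv ℝ f (s, ε) (0, 1))
      (fderiv ℝ (fderiv ℝ f) (δ, ε) (1, 0) (0, 1)) δ := 
    (ContinuousLinearMap.apply ℝ ℝ ((0, 1) : ℝ × ℝ)).hasFDerivAt.comp_hasDerivAt δ
      ((hd2 (δ, ε)).comp_hasDerivAt δ (hl δ ε))
  have h4 : HasDerivAt (fun t => fderiv ℝ f (δ, t) (1, 0))
      (fderiv ℝ (fderiv ℝ f) (δ, ε) (0, 1) (1, 0)) ε := 
    (ContinuousLinearMap.apply ℝ ℝ ((1, 0) : ℝ × ℝ)).hasFDerivAt.comp_hasDerivAt ε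
      ((hd2 (δ, ε)).comp_hasDerivAt ε (hr δ ε))
  rw [funext fun s => h1 s ε, funext fun t => h2 δ t, h3.deriv, h4.deriv]
  exact hs _ _

/-- Derivatives in a parameter commute with Taylor coefficients. -/
theorem IsSchwartz.hasDerivAt_taylorCoeff {f : ℝ × ℝ → ℝ} (hf : IsSchwartz f) (k : ℕ) :
    HasDerivAt (fun s => MultiScale.taylorCoeff k (fun t => f (s, t)))
      (MultiScale.taylorCoeff k (fun t => deriv (fun s => f (s, t)) 0)) 0 := by
  have hcomm : ∀ (k : ℕ) (δ ε : ℝ), deriv (fun s => iteratedDeriv k (fun t => f (s, t)) ε) δ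
      = iteratedDeriv k (fun t => deriv (fun s => f (s, t)) δ) ε := by
    intro k
    induction k with
    | zero => simp
    | succ k ih =>
      intro δ ε
      have h := (hf.iteratedDeriv_snd k).deriv_deriv_comm δ ε
      simp only [iteratedDeriv_succ]
      rw [h]
      congr 1
      exact funext fun t => ih δ t
  have hd : DifferentiableAt ℝ (fun s => iteratedDeriv k (fun t => f (s, t)) 0) 0 :=
    ((hf.iteratedDeriv_snd k).slice_snd 0).contDiff.differentiable (by simp) 0
  have := hd.hasDerivAt.div_const (k.factorial : ℝ)
  rw [hcomm] at this
  exact this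

/-! ### Scale lines -/

section Lines

instance (n p : ℕ) : (volume : Measure (Fin n → Fin p → ℝ)).IsAddHaarMeasure :=
  Measure.pi.isAddHaarMeasure fun _ : Fin n => (volume : Measure (Fin p → ℝ))

/-- A Haar measure has temperate growth, which makes Schwartz functions of label and line variable
integrable. -/
instance (n p : ℕ) :
    (volume.prod volume : Measure ((Fin n → Fin p → ℝ) × (Fin p → ℝ))).HasTemperateGrowth :=
  have : (volume.prod volume : Measure ((Fin n → Fin p → ℝ) × (Fin p → ℝ))).IsAddHaarMeasure :=
    Measure.prod.instIsAddHaarMeasure volume volume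
  inferInstance

variable {P : Type} [NormedAddCommGroup P] [NormedSpace ℝ P] {p q N r : ℕ}

/-- The labels of the scale line through `y`. -/
def lineLabel (ε : ℝ) (y : Scales p r) : Fin r → Space p :=
  fun i => y i.succ - ε ^ ((i : ℕ) + 1) • y 0

/-- The scale line with label `l`. -/
def labelLine (ε : ℝ) (l : Fin r → Space p) (x : Space p) : Scales p r :=
  scaleLine ε (Fin.cons 0 l) x

theorem labelLine_zero (ε : ℝ) (l : Fin r → Space p) (x : Space p) : labelLine ε l x 0 = x := by
  simp [labelLine, scaleLine]

theorem labelLine_succ (ε : ℝ) (l : Fin r → Space p) (x : Space p) (i : Fin r) :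
    labelLine ε l x i.succ = l i + ε ^ ((i : ℕ) + 1) • x := by
  simp [labelLine, scaleLine]

theorem lineLabel_labelLine (ε : ℝ) (l : Fin r → Space p) (x : Space p) :
    lineLabel ε (labelLine ε l x) = l := by
  funext i
  simp [lineLabel, labelLine_zero, labelLine_succ]

theorem scaleLine_eq_labelLine (ε : ℝ) (y : Scales p r) :
    scaleLine ε y = labelLine ε (lineLabel ε y) := by
  funext x i
  refine Fin.cases ?_ (fun i => ?_) i
  · simp [scaleLine, labelLine_zero]
  · rw [labelLine_succ]
    simp only [scaleLine, lineLabel, Fin.val_succ, smul_sub]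
    abel

/-- Bounds y_i ∓ ε^(i+1) x when y, ε and x have norm at most `M`: passing between labels and scales
costs a polynomial of degree at most r + 1. -/
theorem add_pow_mul_le {M : ℝ} (hM : 0 ≤ M) {r i : ℕ} (hi : i < r) :
    M + M ^ (i + 1) * M ≤ 2 * (1 + M) ^ (r + 1) := by
  have h1 : M ≤ (1 + M) ^ (r + 1) :=
    (by linarith : M ≤ 1 + M).trans (le_self_pow₀ (by linarith) (Nat.succ_ne_zero r))
  have h2 : M ^ (i + 1) * M ≤ (1 + M) ^ (r + 1) := by
    rw [← pow_succ]
    exact (pow_le_pow_left₀ hM (by linarith) _).trans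
      (pow_le_pow_right₀ (by linarith) (by omega))
  linarith

/-- The change of variables (l, ε, x) ↦ (y, ε) is polynomial with polynomial inverse, so it
preserves rapid decay although ε varies as well. -/
theorem IsSchwartz.comp_labelLine {f : (P × Scales p r) × ℝ → ℝ} (hf : IsSchwartz f) :
    IsSchwartz (fun z : ((P × (Fin r → Space p)) × ℝ) × Space p =>
      f ((z.1.1.1, labelLine z.1.2 z.1.1.2 z.2), z.1.2)) := by
  refine hf.comp (g := fun z : ((P × (Fin r → Space p)) × ℝ) × Space p =>
    ((z.1.1.1, labelLine z.1.2 z.1.1.2 z.2), z.1.2)) ?_ ⟨r + 1, 2, fun z => ?_⟩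
  · have h1 : (fun z : ((P × (Fin r → Space p)) × ℝ) × Space p => z.1.1.1).HasTemperateGrowth :=
      (((ContinuousLinearMap.fst ℝ P (Fin r → Space p)).comp
        (ContinuousLinearMap.fst ℝ (P × (Fin r → Space p)) ℝ)).comp
        (ContinuousLinearMap.fst ℝ ((P × (Fin r → Space p)) × ℝ) (Space p))).hasTemperateGrowth
    have h2 (i : Fin r) : (fun z : ((P × (Fin r → Space p)) × ℝ) × Space p =>
        z.1.1.2 i).HasTemperateGrowth :=
      (((ContinuousLinearMap.proj (R := ℝ) (φ := fun _ : Fin r => Space p) i).comp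
        (ContinuousLinearMap.snd ℝ P (Fin r → Space p))).comp
        ((ContinuousLinearMap.fst ℝ (P × (Fin r → Space p)) ℝ).comp
        (ContinuousLinearMap.fst ℝ ((P × (Fin r → Space p)) × ℝ) (Space p)))).hasTemperateGrowth
    have h3 : (fun z : ((P × (Fin r → Space p)) × ℝ) × Space p => z.1.2).HasTemperateGrowth :=
      ((ContinuousLinearMap.snd ℝ (P × (Fin r → Space p)) ℝ).comp
        (ContinuousLinearMap.fst ℝ ((P × (Fin r → Space p)) × ℝ) (Space p))).hasTemperateGrowth
    have h4 : (fun z : ((P × (Fin r → Space p)) × ℝ) × Space p => z.2).HasTemperateGrowth :=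
      (ContinuousLinearMap.snd ℝ ((P × (Fin r → Space p)) × ℝ) (Space p)).hasTemperateGrowth
    refine (h1.prodMk (Function.HasTemperateGrowth.pi fun i => ?_)).prodMk h3
    refine Fin.cases ?_ (fun i => ?_) i
    · simpa only [labelLine_zero] using h4
    · simp only [labelLine_succ]
      exact (h2 i).add ((h3.pow _).smul h4)
  · set w : (P × Scales p r) × ℝ := ((z.1.1.1, labelLine z.1.2 z.1.1.2 z.2), z.1.2) with hw
    have hM := norm_nonneg w
    have hle : ‖w‖ ≤ 2 * (1 + ‖w‖) ^ (r + 1) := by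
      have h1 : 1 + ‖w‖ ≤ (1 + ‖w‖) ^ (r + 1) :=
        le_self_pow₀ (by linarith) (Nat.succ_ne_zero r)
      linarith
    have hs : ‖z.1.1.1‖ ≤ ‖w‖ := (norm_fst_le w.1).trans (norm_fst_le w)
    have hε : ‖z.1.2‖ ≤ ‖w‖ := norm_snd_le w
    have hl : ‖labelLine z.1.2 z.1.1.2 z.2‖ ≤ ‖w‖ := (norm_snd_le w.1).trans (norm_fst_le w)
    have hx : ‖z.2‖ ≤ ‖w‖ := by
      have := norm_le_pi_norm (labelLine z.1.2 z.1.1.2 z.2) 0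
      rw [labelLine_zero] at this
      exact this.trans hl
    refine max_le (max_le (max_le (hs.trans hle) ?_) (hε.trans hle)) (hx.trans hle)
    refine (pi_norm_le_iff_of_nonneg (by positivity)).2 fun i => ?_
    refine le_trans ?_ (add_pow_mul_le hM i.2)
    have h1 : z.1.1.2 i = labelLine z.1.2 z.1.1.2 z.2 i.succ - z.1.2 ^ ((i : ℕ) + 1) • z.2 := by
      rw [labelLine_succ]; abel
    rw [h1]
    refine (norm_sub_le _ _).trans (add_le_add ((norm_le_pi_norm _ _).trans hl) ?_)
    rw [norm_smul, norm_pow]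
    gcongr

/-- The inverse change of variables, for the same reason. -/
theorem IsSchwartz.comp_lineLabel {f : ((P × (Fin r → Space p)) × ℝ) × Space p → ℝ}
    (hf : IsSchwartz f) :
    IsSchwartz (fun z : (P × Scales p r) × ℝ =>
      f (((z.1.1, lineLabel z.2 z.1.2), z.2), z.1.2 0)) := by
  refine hf.comp (g := fun z : (P × Scales p r) × ℝ =>
    (((z.1.1, lineLabel z.2 z.1.2), z.2), z.1.2 0)) ?_ ⟨r + 1, 2, fun z => ?_⟩
  · have h1 : (fun z : (P × Scales p r) × ℝ => z.1.1).HasTemperateGrowth :=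
      ((ContinuousLinearMap.fst ℝ P (Scales p r)).comp
        (ContinuousLinearMap.fst ℝ (P × Scales p r) ℝ)).hasTemperateGrowth
    have h2 (i : Fin (r + 1)) : (fun z : (P × Scales p r) × ℝ => z.1.2 i).HasTemperateGrowth :=
      (((ContinuousLinearMap.proj (R := ℝ) (φ := fun _ : Fin (r + 1) => Space p) i).comp
        (ContinuousLinearMap.snd ℝ P (Scales p r))).comp
        (ContinuousLinearMap.fst ℝ (P × Scales p r) ℝ)).hasTemperateGrowth
    have h3 : (fun z : (P × Scales p r) × ℝ => z.2).HasTemperateGrowth :=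
      (ContinuousLinearMap.snd ℝ (P × Scales p r) ℝ).hasTemperateGrowth
    refine ((h1.prodMk (Function.HasTemperateGrowth.pi fun i => ?_)).prodMk h3).prodMk (h2 0)
    exact (h2 i.succ).sub ((h3.pow _).smul (h2 0))
  · set w : ((P × (Fin r → Space p)) × ℝ) × Space p :=
      (((z.1.1, lineLabel z.2 z.1.2), z.2), z.1.2 0) with hw
    have hM := norm_nonneg w
    have hle : ‖w‖ ≤ 2 * (1 + ‖w‖) ^ (r + 1) := by
      have h1 : 1 + ‖w‖ ≤ (1 + ‖w‖) ^ (r + 1) :=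
        le_self_pow₀ (by linarith) (Nat.succ_ne_zero r)
      linarith
    have hs : ‖z.1.1‖ ≤ ‖w‖ := ((norm_fst_le w.1.1).trans (norm_fst_le w.1)).trans (norm_fst_le w)
    have hl : ‖lineLabel z.2 z.1.2‖ ≤ ‖w‖ :=
      ((norm_snd_le w.1.1).trans (norm_fst_le w.1)).trans (norm_fst_le w)
    have hε : ‖z.2‖ ≤ ‖w‖ := (norm_snd_le w.1).trans (norm_fst_le w)
    have hx : ‖z.1.2 0‖ ≤ ‖w‖ := norm_snd_le w
    refine max_le (max_le (hs.trans hle) ?_) (hε.trans hle)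
    refine (pi_norm_le_iff_of_nonneg (by positivity)).2 fun i => ?_
    refine Fin.cases (hx.trans hle) (fun i => ?_) i
    refine le_trans ?_ (add_pow_mul_le hM i.2)
    have h1 : z.1.2 i.succ = lineLabel z.2 z.1.2 i + z.2 ^ ((i : ℕ) + 1) • z.1.2 0 := by
      simp [lineLabel]
    rw [h1]
    refine (norm_add_le _ _).trans (add_le_add ((norm_le_pi_norm _ _).trans hl) ?_)
    rw [norm_smul, norm_pow]
    gcongr

/-- Integration over all scales, line by line. -/
theorem integral_labelLine {f : Scales p r → ℝ} (hf : IsSchwartz f) (ε : ℝ) :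
    ∫ l : Fin r → Space p, ∫ x, f (labelLine ε l x) = ∫ y, f y := by
  have hcons : ∀ (x : Space p) (l : Fin r → Space p),
      (MeasurableEquiv.piFinSuccAbove (fun _ : Fin (r + 1) => Space p) 0).symm (x, l)
        = (Fin.cons x l : Scales p r) := fun x l => by
    simp [MeasurableEquiv.piFinSuccAbove, Fin.insertNthEquiv]
  have hmp := (volume_preserving_piFinSuccAbove (fun _ : Fin (r + 1) => Space p) 0).symm
  have h1 : ∫ y, f y = ∫ z : Space p × (Fin r → Space p), f (Fin.cons z.1 z.2) := by
    rw [← hmp.integral_comp (MeasurableEquiv.measurableEmbedding _)]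
    simp only [← hcons]
  -- At fixed x the labels are a translate of (y₁, …, y_r), so Fubini and translation invariance
  -- suffice.
  have hshear : ∀ (x : Space p) (l : Fin r → Space p), labelLine ε l x
      = Fin.cons x (l + fun i : Fin r => ε ^ ((i : ℕ) + 1) • x) := fun x l => by
    funext i
    refine Fin.cases ?_ (fun i => ?_) i
    · simp [labelLine_zero]
    · simp [labelLine_succ]
  have hint1 : Integrable (fun z : Space p × (Fin r → Space p) =>
      f (Fin.cons z.1 z.2)) volume := by
    have := (hmp.integrable_comp_emb (MeasurableEquiv.measurableEmbedding _)
      (g := f)).2 (hf.integrable (μ := volume))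
    refine this.congr (Filter.Eventually.of_forall fun z => ?_)
    simp only [Function.comp_apply, ← hcons]
  rw [h1, Measure.volume_eq_prod, integral_prod _ hint1]
  have h2 : ∀ x : Space p, ∫ l : Fin r → Space p, f (Fin.cons x l)
      = ∫ l : Fin r → Space p, f (labelLine ε l x) := fun x => by
    simp only [hshear]
    exact (integral_add_right_eq_self (fun l : Fin r → Space p => f (Fin.cons x l)) _).symm
  simp only [h2]
  refine integral_integral_swap (f := fun l x => f (labelLine ε l x)) ?_
  -- Exchanging the integrals needs joint integrability. At fixed ε the map from labels and x to y
  -- is linear, and its left inverse `L'` gives the required lower bound on its growth.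
  have hsch : IsSchwartz (fun z : (Fin r → Space p) × Space p => f (labelLine ε z.1 z.2)) := by
    let L : ((Fin r → Space p) × Space p) →L[ℝ] Scales p r :=
      ContinuousLinearMap.pi fun i => Fin.cases (ContinuousLinearMap.snd ℝ _ _)
        (fun i => (ContinuousLinearMap.proj i).comp (ContinuousLinearMap.fst ℝ _ _)
          + ε ^ ((i : ℕ) + 1) • ContinuousLinearMap.snd ℝ _ _) i
    have hL : ∀ z, L z = labelLine ε z.1 z.2 := fun z => by
      funext i
      refine Fin.cases ?_ (fun i => ?_) i
      · simp [L, labelLine_zero]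
      · simp [L, labelLine_succ]
    have hinj : ∀ z, (lineLabel ε (L z), L z 0) = z := fun z => by
      rw [hL, lineLabel_labelLine, labelLine_zero]
    let L' : Scales p r →L[ℝ] ((Fin r → Space p) × Space p) :=
      (ContinuousLinearMap.pi fun i : Fin r => ContinuousLinearMap.proj i.succ
        - ε ^ ((i : ℕ) + 1) • ContinuousLinearMap.proj 0).prod (ContinuousLinearMap.proj 0)
    have h := hf.comp L.hasTemperateGrowth ⟨1, ‖L'‖, fun z => ?_⟩
    · simpa only [hL] using h
    · have h1 : L' (L z) = z := hinj z
      calc ‖z‖ = ‖L' (L z)‖ := by rw [h1]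
        _ ≤ ‖L'‖ * ‖L z‖ := L'.le_opNorm _
        _ ≤ _ := by
          rw [pow_one]
          gcongr
          linarith
  exact hsch.integrable (μ := volume.prod volume)

end Lines

/-! ### Families of Schwartz functions -/

section Families

variable {P X : Type} [NormedAddCommGroup P] [NormedSpace ℝ P] [NormedAddCommGroup X]
  [NormedSpace ℝ X] {ι : Type} [Fintype ι]

theorem schwartzFamily_iff {u : P → 𝓢(X, ι → ℝ)} :
    SchwartzFamily u ↔ IsSchwartz (fun z : P × X => u z.1 z.2) :=
  ⟨fun ⟨F, hF⟩ => ⟨F, funext fun z => hF z.1 z.2⟩,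
    fun ⟨F, hF⟩ => ⟨F, fun s x => congrFun hF (s, x)⟩⟩

theorem schwartzFamily_of_apply {u : P → 𝓢(X, ι → ℝ)}
    (h : ∀ a, IsSchwartz (fun z : P × X => u z.1 z.2 a)) : SchwartzFamily u :=
  schwartzFamily_iff.2 (IsSchwartz.pi h)

theorem SchwartzFamily.apply {u : P → 𝓢(X, ι → ℝ)} (h : SchwartzFamily u) (a : ι) :
    IsSchwartz (fun z : P × X => u z.1 z.2 a) :=
  (schwartzFamily_iff.1 h).apply a

theorem exists_schwartzFamily {f : P × X → ι → ℝ} (hf : IsSchwartz f) :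
    ∃ u : P → 𝓢(X, ι → ℝ), SchwartzFamily u ∧ ∀ s x, u s x = f (s, x) := by
  have h : ∀ s, ∃ F : 𝓢(X, ι → ℝ), ⇑F = fun x => f (s, x) := fun s => by
    refine hf.comp (g := fun x : X => (s, x)) (by fun_prop) ⟨1, 1, fun x => ?_⟩
    have : ‖x‖ ≤ ‖(s, x)‖ := le_max_right _ _
    rw [pow_one, one_mul]
    linarith
  choose u hu using h
  have hu' : ∀ s x, u s x = f (s, x) := fun s x => congrFun (hu s) x
  exact ⟨u, schwartzFamily_iff.2 (hf.congr fun z => (hu' z.1 z.2).symm), hu'⟩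

/-- A constant family does not decay in a genuine parameter. Single fields are therefore treated as
families over a point, and elsewhere multiplied by a cut-off. -/
theorem SchwartzFamily.const [Subsingleton P] (u : 𝓢(X, ι → ℝ)) :
    SchwartzFamily (fun _ : P => u) := by
  refine schwartzFamily_iff.2 ((SchwartzMap.isSchwartz u).comp (g := fun z : P × X => z.2)
    (by fun_prop) ⟨1, 1, fun z => ?_⟩)
  have h : ‖z.1‖ = 0 := by rw [Subsingleton.elim z.1 0, norm_zero]
  rw [Prod.norm_def, h, max_eq_right (norm_nonneg _)]
  linarith

theorem SchwartzFamily.tensor {χ : P → ℝ} (hχ : IsSchwartz χ) (u : 𝓢(X, ι → ℝ)) :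
    SchwartzFamily (fun s => χ s • u) :=
  schwartzFamily_of_apply fun a => hχ.tensor ((SchwartzMap.isSchwartz u).apply a)

theorem SchwartzFamily.add {u v : P → 𝓢(X, ι → ℝ)} (hu : SchwartzFamily u)
    (hv : SchwartzFamily v) : SchwartzFamily (fun s => u s + v s) :=
  schwartzFamily_iff.2 ((schwartzFamily_iff.1 hu).add (schwartzFamily_iff.1 hv))

theorem SchwartzFamily.smul {c : P → ℝ} (hc : c.HasTemperateGrowth) {u : P → 𝓢(X, ι → ℝ)}
    (hu : SchwartzFamily u) : SchwartzFamily (fun s => c s • u s) :=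
  schwartzFamily_iff.2 (IsSchwartz.smul (c := fun z : P × X => c z.1)
    (hc.comp (f := fun z : P × X => z.1) (by fun_prop)) (schwartzFamily_iff.1 hu))

/-- The product of a Schwartz function of one parameter and a Schwartz family. -/
theorem SchwartzFamily.tensor_family {P' : Type} [NormedAddCommGroup P'] [NormedSpace ℝ P']
    {χ : P' → ℝ} (hχ : IsSchwartz χ) {u : P → 𝓢(X, ι → ℝ)} (hu : SchwartzFamily u) :
    SchwartzFamily (fun s : P' × P => χ s.1 • u s.2) := by
  refine schwartzFamily_of_apply fun a => ?_
  refine (hχ.tensor (hu.apply a)).comp (g := fun z : (P' × P) × X => (z.1.1, (z.1.2, z.2)))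
    (by fun_prop) ⟨1, 1, fun z => ?_⟩
  simp only [Prod.norm_def, one_mul, pow_one]
  grind

theorem SchwartzFamily.dotProduct {u v : P → 𝓢(X, ι → ℝ)} (hu : SchwartzFamily u)
    (hv : SchwartzFamily v) : IsSchwartz (fun z : P × X => u z.1 z.2 ⬝ᵥ v z.1 z.2) :=
  IsSchwartz.sum _ fun a _ => (hv.apply a).mul (hu.apply a).hasTemperateGrowth

theorem SchwartzFamily.pairing [MeasureSpace X] [BorelSpace X] [SecondCountableTopology X]
    [(volume : Measure X).HasTemperateGrowth] {u v : P → 𝓢(X, ι → ℝ)} (hu : SchwartzFamily u)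
    (hv : SchwartzFamily v) : IsSchwartz (fun s => MultiScale.pairing (u s) (v s)) :=
  (hu.dotProduct hv).integral volume

end Families

/-! ### The perturbation series on scale lines -/

section Series

variable {p q N r : ℕ}

/-- Reversal of the order of the components of a column, which turns tangent vectors into cotangent
vectors. -/
def rev : BigField p q N r →L[ℝ] BigField p q N r :=
  SchwartzMap.postcompCLM (𝕜 := ℝ)
    (ContinuousLinearMap.pi fun ja : Fin (N + 1) × Fin q =>
      (ContinuousLinearMap.proj (ja.1.rev, ja.2) : (Fin (N + 1) × Fin q → ℝ) →L[ℝ] ℝ))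

theorem rev_apply (η : BigField p q N r) (y : Scales p r) (ja : Fin (N + 1) × Fin q) :
    rev η y ja = η y (ja.1.rev, ja.2) := rfl

theorem rev_rev (η : BigField p q N r) : rev (rev η) = η := by
  ext y ja
  simp [rev_apply]

/-- The perturbation series on the scale line with label `l`. -/
def lineSeries (ε : ℝ) (l : Fin r → Space p) (η : BigField p q N r) : Field p q :=
  uHat ε (Fin.cons 0 l) η

theorem uHat_apply (ε : ℝ) (y : Scales p r) (η : BigField p q N r) (x : Space p) (a : Fin q) :
    uHat ε y η x a = ∑ j : Fin (N + 1), ε ^ (j : ℕ) * η (scaleLine ε y x) (j, a) := by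
  simp [uHat, Finset.sum_apply, lineComponent_apply]

theorem lineSeries_apply (ε : ℝ) (l : Fin r → Space p) (η : BigField p q N r) (x : Space p)
    (a : Fin q) :
    lineSeries ε l η x a = ∑ j : Fin (N + 1), ε ^ (j : ℕ) * η (labelLine ε l x) (j, a) :=
  uHat_apply ε _ η x a

/-- The parametrization by x = y₀ depends only on the line and not on the point chosen on it. -/
theorem uHat_eq_lineSeries (ε : ℝ) (y : Scales p r) (η : BigField p q N r) :
    uHat ε y η = lineSeries ε (lineLabel ε y) η := by
  ext x a
  rw [uHat_apply, lineSeries_apply, scaleLine_eq_labelLine]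

theorem lineComponent_eq (ε : ℝ) (y : Scales p r) (j : Fin (N + 1)) (η : BigField p q N r) :
    lineComponent ε y j η = lineComponent ε (Fin.cons 0 (lineLabel ε y)) j η := by
  ext x a
  rw [lineComponent_apply, lineComponent_apply, scaleLine_eq_labelLine]
  rfl

theorem lineSeries_add (ε : ℝ) (l : Fin r → Space p) (η ζ : BigField p q N r) :
    lineSeries ε l (η + ζ) = lineSeries ε l η + lineSeries ε l ζ := by
  ext x a
  simp [lineSeries_apply, mul_add, Finset.sum_add_distrib]

theorem lineSeries_smul (ε : ℝ) (l : Fin r → Space p) (c : ℝ) (η : BigField p q N r) :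
    lineSeries ε l (c • η) = c • lineSeries ε l η := by
  ext x a
  simp only [lineSeries_apply, _root_.smul_apply, Pi.smul_apply, smul_eq_mul, Finset.mul_sum]
  exact Finset.sum_congr rfl fun j _ => by ring

theorem lineSeries_zero (ε : ℝ) (l : Fin r → Space p) :
    lineSeries ε l (0 : BigField p q N r) = 0 := by
  ext x a
  simp [lineSeries_apply]

/-- The weights ε^(N-j) are what shifts the coefficient i to i + j - N, the index occurring in Ĵ_N.
-/
theorem lineSeries_rev (ε : ℝ) (l : Fin r → Space p) (η : BigField p q N r) :
    lineSeries ε l (rev η)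
      = ∑ j : Fin (N + 1), ε ^ (N - j : ℕ) • lineComponent ε (Fin.cons 0 l) j η := by
  ext x a
  simp only [lineSeries_apply, _root_.sum_apply, Finset.sum_apply, _root_.smul_apply,
    Pi.smul_apply, smul_eq_mul, lineComponent_apply, rev_apply]
  rw [← Equiv.sum_comp Fin.revPerm]
  refine Finset.sum_congr rfl fun j _ => ?_
  simp only [Fin.revPerm_apply, Fin.rev_rev, Fin.val_rev, labelLine]
  congr 2
  omega

end Series

/-! ### Smooth families of fields and functions on scale lines -/

section LineFamilies

variable {P : Type} [NormedAddCommGroup P] [NormedSpace ℝ P] {p q N r : ℕ}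

/-- Near `ε = 0`, `w` is a Schwartz family of fields on the scale lines. -/
def IsLineFamily (w : P → (Fin r → Space p) → ℝ → Field p q) : Prop :=
  ∃ W : (P × (Fin r → Space p)) × ℝ → Field p q, SchwartzFamily W ∧
    ∀ᶠ ε in 𝓝 (0 : ℝ), ∀ s l, w s l ε = W ((s, l), ε)

/-- Near `ε = 0`, `f` is a Schwartz function of the parameters and the labels of scale lines. -/
def IsLineFunction (f : P → (Fin r → Space p) → ℝ → ℝ) : Prop :=
  ∃ F : (P × (Fin r → Space p)) × ℝ → ℝ, IsSchwartz F ∧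
    ∀ᶠ ε in 𝓝 (0 : ℝ), ∀ s l, f s l ε = F ((s, l), ε)

namespace IsLineFamily

variable {w v : P → (Fin r → Space p) → ℝ → Field p q}

theorem congr (hw : IsLineFamily w) (h : ∀ᶠ ε in 𝓝 (0 : ℝ), ∀ s l, v s l ε = w s l ε) :
    IsLineFamily v := by
  obtain ⟨W, hW, hw⟩ := hw
  refine ⟨W, hW, ?_⟩
  filter_upwards [hw, h] with ε h1 h2 s l
  rw [h2, h1]

theorem add (hw : IsLineFamily w) (hv : IsLineFamily v) :
    IsLineFamily (fun s l ε => w s l ε + v s l ε) := by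
  obtain ⟨W, hW, hw⟩ := hw
  obtain ⟨V, hV, hv⟩ := hv
  refine ⟨_, hW.add hV, ?_⟩
  filter_upwards [hw, hv] with ε h1 h2 s l
  rw [h2, h1]

theorem pow_smul (hw : IsLineFamily w) (k : ℕ) : IsLineFamily (fun s l ε => ε ^ k • w s l ε) := by
  obtain ⟨W, hW, hw⟩ := hw
  refine ⟨_, hW.smul (c := fun s => s.2 ^ k) (by fun_prop), ?_⟩
  filter_upwards [hw] with ε h1 s l
  rw [h1]

theorem of_labelLine {f : (P × Scales p r) × ℝ → Fin q → ℝ}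
    (hf : ∀ a, IsSchwartz (fun z => f z a))
    (h : ∀ᶠ ε in 𝓝 (0 : ℝ), ∀ s l x, w s l ε x = f ((s, labelLine ε l x), ε)) :
    IsLineFamily w := by
  obtain ⟨W, hW, hWf⟩ := exists_schwartzFamily (IsSchwartz.pi fun a => (hf a).comp_labelLine)
  refine ⟨W, hW, ?_⟩
  filter_upwards [h] with ε h s l
  ext x a
  rw [h, hWf]

/-- Returns from labels to scales. The label of a fixed y moves with ε, so Taylor coefficients at
fixed y also see the motion of the line. -/
theorem exists_along {w : P → (Fin r → Space p) → ℝ → Field p q} (hw : IsLineFamily w) :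
    ∃ f : (P × Scales p r) × ℝ → Fin q → ℝ, (∀ a, IsSchwartz (fun z => f z a)) ∧
      ∀ᶠ ε in 𝓝 (0 : ℝ), ∀ s y, w s (lineLabel ε y) ε (y 0) = f ((s, y), ε) := by
  obtain ⟨W, hW, hw⟩ := hw
  refine ⟨_, fun a => (hW.apply a).comp_lineLabel, ?_⟩
  filter_upwards [hw] with ε h1 s y
  rw [h1]

theorem lineSeries {η : P → BigField p q N r} (hη : SchwartzFamily η) :
    IsLineFamily (fun s l ε => MultiScale.lineSeries ε l (η s)) := by
  -- Powers of ε do not decay; a cut-off equal to 1 near 0 leaves the family unchanged there.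
  obtain ⟨χ, hχ, h1⟩ := exists_cutoff isOpen_univ (Set.mem_univ (0 : ℝ))
  refine of_labelLine (f := fun z a => ∑ j : Fin (N + 1),
    z.2 ^ (j : ℕ) * (η z.1.1 z.1.2 (j, a) * χ z.2)) (fun a => ?_) ?_
  · exact IsSchwartz.sum _ fun j _ => ((hη.apply (j, a)).tensor hχ.isSchwartz).mul
      (c := fun z : (P × Scales p r) × ℝ => z.2 ^ (j : ℕ)) (by fun_prop)
  · filter_upwards [h1] with ε h1 s l x
    ext a
    simp only [lineSeries_apply, h1, mul_one]

theorem lineComponent {η : P → BigField p q N r} (hη : SchwartzFamily η) (j : Fin (N + 1)) :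
    IsLineFamily (fun s l ε => MultiScale.lineComponent ε (Fin.cons 0 l) j (η s)) := by
  obtain ⟨χ, hχ, h1⟩ := exists_cutoff isOpen_univ (Set.mem_univ (0 : ℝ))
  refine of_labelLine (f := fun z a => η z.1.1 z.1.2 (j, a) * χ z.2)
    (fun a => (hη.apply (j, a)).tensor hχ.isSchwartz) ?_
  filter_upwards [h1] with ε h1 s l x
  ext a
  simp only [lineComponent_apply, h1, mul_one]
  rfl

theorem tensor {φ : P → ℝ} (hφ : IsSchwartz φ)
    {w : Unit → (Fin r → Space p) → ℝ → Field p q} (hw : IsLineFamily w) :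
    IsLineFamily (fun s l ε => φ s • w () l ε) := by
  obtain ⟨W, hW, hw⟩ := hw
  have h := schwartzFamily_iff.1 (SchwartzFamily.tensor_family hφ hW)
  refine ⟨fun z => φ z.1.1 • W (((), z.1.2), z.2), schwartzFamily_iff.2 (h.comp
    (g := fun z : ((P × (Fin r → Space p)) × ℝ) × Space p =>
      ((z.1.1.1, (((), z.1.1.2), z.1.2)), z.2)) (by fun_prop) ⟨1, 1, fun z => ?_⟩), ?_⟩
  · simp only [Prod.norm_def, one_mul, pow_one]
    grind
  · filter_upwards [hw] with ε h1 s l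
    rw [h1]

/-- Smoothness of `K` gives decay in the labels only after subtraction of the value at the zero
field, which is the same on all lines. -/
theorem field [FiniteDimensional ℝ P] {I : Set ℝ} (hI : IsOpen I) (h0 : (0 : ℝ) ∈ I)
    {K : ℝ → Field p q → Field p q} (hK : IsSmoothField I K) (hw : IsLineFamily w) :
    IsLineFamily (fun s l ε => K ε (w s l ε) - K ε 0) := by
  obtain ⟨χ, hχ, h1⟩ := exists_cutoff hI h0
  obtain ⟨W, hW, hw⟩ := hw
  refine ⟨_, hK.family _ W hW χ hχ, ?_⟩
  filter_upwards [hw, h1] with ε hw h1 s l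
  rw [hw, h1, one_smul]

theorem operator [FiniteDimensional ℝ P] {I : Set ℝ} (hI : IsOpen I) (h0 : (0 : ℝ) ∈ I)
    {J : ℝ → Field p q → Field p q → Field p q} (hJ : IsSmoothOperator I J)
    (hw : IsLineFamily w) (hv : IsLineFamily v) :
    IsLineFamily (fun s l ε => J ε (w s l ε) (v s l ε)) := by
  obtain ⟨χ, hχ, h1⟩ := exists_cutoff hI h0
  obtain ⟨W, hW, hw⟩ := hw
  obtain ⟨V, hV, hv⟩ := hv
  refine ⟨_, hJ.family _ W V hW hV χ hχ, ?_⟩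
  filter_upwards [hw, hv, h1] with ε hw hv h1 s l
  rw [hw, hv, h1, one_smul]

/-- Fields which do not depend on the line. -/
theorem of_zero {I : Set ℝ} (hI : IsOpen I) (h0 : (0 : ℝ) ∈ I)
    {K : ℝ → Field p q → Field p q} (hK : IsSmoothField I K)
    (hr : 0 < r → ∀ ε ∈ I, K ε 0 = 0) :
    IsLineFamily (fun (_ : Unit) (_ : Fin r → Space p) ε => K ε 0) := by
  obtain ⟨χ, hχ, h1⟩ := exists_cutoff hI h0
  -- Without slow scales there is a single label and a cut-off in ε is enough; otherwise a field
  -- constant in the labels must vanish in order to decay.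
  rcases Nat.eq_zero_or_pos r with rfl | hr'
  · refine ⟨fun z => χ z.2 • K z.2 0, ?_, ?_⟩
    · refine schwartzFamily_iff.2 ((schwartzFamily_iff.1 (hK.zero χ hχ)).comp
        (g := fun z : ((Unit × (Fin 0 → Space p)) × ℝ) × Space p => (z.1.2, z.2))
        (by fun_prop) ⟨1, 1, fun z => ?_⟩)
      have h : ‖z.1.1‖ = 0 := by rw [Subsingleton.elim z.1.1 0, norm_zero]
      simp only [Prod.norm_def z, Prod.norm_def z.1, h, one_mul, pow_one]
      simp only [Prod.norm_def]
      grind [norm_nonneg]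
    · filter_upwards [h1] with ε h1 s l
      rw [h1, one_smul]
  · refine ⟨fun _ => 0, schwartzFamily_iff.2 IsSchwartz.zero, ?_⟩
    filter_upwards [hI.mem_nhds h0] with ε hε s l
    exact hr hr' ε hε

end IsLineFamily

namespace IsLineFunction

variable {f g : P → (Fin r → Space p) → ℝ → ℝ}

theorem congr (hf : IsLineFunction f) (h : ∀ᶠ ε in 𝓝 (0 : ℝ), ∀ s l, g s l ε = f s l ε) :
    IsLineFunction g := by
  obtain ⟨F, hF, hf⟩ := hf
  refine ⟨F, hF, ?_⟩
  filter_upwards [hf, h] with ε h1 h2 s l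
  rw [h2, h1]

theorem add (hf : IsLineFunction f) (hg : IsLineFunction g) :
    IsLineFunction (fun s l ε => f s l ε + g s l ε) := by
  obtain ⟨F, hF, hf⟩ := hf
  obtain ⟨G, hG, hg⟩ := hg
  refine ⟨_, hF.add hG, ?_⟩
  filter_upwards [hf, hg] with ε h1 h2 s l
  rw [h2, h1]

theorem pairing {w v : P → (Fin r → Space p) → ℝ → Field p q} (hw : IsLineFamily w)
    (hv : IsLineFamily v) : IsLineFunction (fun s l ε => MultiScale.pairing (w s l ε) (v s l ε)) := by
  obtain ⟨W, hW, hw⟩ := hw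
  obtain ⟨V, hV, hv⟩ := hv
  refine ⟨_, hW.pairing hV, ?_⟩
  filter_upwards [hw, hv] with ε h1 h2 s l
  rw [h2, h1]

theorem function [FiniteDimensional ℝ P] {I : Set ℝ} (hI : IsOpen I) (h0 : (0 : ℝ) ∈ I)
    {H : ℝ → Field p q → ℝ} (hH : IsSmoothFunction I H)
    {w : P → (Fin r → Space p) → ℝ → Field p q} (hw : IsLineFamily w) :
    IsLineFunction (fun s l ε => H ε (w s l ε) - H ε 0) := by
  obtain ⟨χ, hχ, h1⟩ := exists_cutoff hI h0
  obtain ⟨W, hW, hw⟩ := hw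
  obtain ⟨F, hF⟩ := hH.family _ W hW χ hχ
  refine ⟨F, SchwartzMap.isSchwartz F, ?_⟩
  filter_upwards [hw, h1] with ε hw h1 s l
  rw [hw, hF, h1, one_mul]

/-- Being constant in the labels, the value at the zero field decays only if there is one label or
if it is zero. -/
theorem of_zero {I : Set ℝ} (hI : IsOpen I) (h0 : (0 : ℝ) ∈ I)
    {H : ℝ → Field p q → ℝ} (hH : IsSmoothFunction I H) (hr : 0 < r → ∀ ε ∈ I, H ε 0 = 0) :
    IsLineFunction (fun (_ : Unit) (_ : Fin r → Space p) ε => H ε 0) := by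
  obtain ⟨χ, hχ, h1⟩ := exists_cutoff hI h0
  rcases Nat.eq_zero_or_pos r with rfl | hr'
  · refine ⟨fun z => χ z.2 * H z.2 0, ?_, ?_⟩
    · have h : IsSchwartz (fun ε => χ ε * H ε 0) :=
        .of_hasCompactSupport (hχ.compact.mul_right) (hH.zero χ hχ)
      refine h.comp (g := fun z : (Unit × (Fin 0 → Space p)) × ℝ => z.2)
        (by fun_prop) ⟨1, 1, fun z => ?_⟩
      have h : ‖z.1‖ = 0 := by rw [Subsingleton.elim z.1 0, norm_zero]
      rw [Prod.norm_def z, h, max_eq_right (norm_nonneg _)]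
      linarith
    · filter_upwards [h1] with ε h1 s l
      rw [h1, one_mul]
  · refine ⟨fun _ => 0, IsSchwartz.zero, ?_⟩
    filter_upwards [hI.mem_nhds h0] with ε hε s l
    exact hr hr' ε hε

theorem integrable (hf : IsLineFunction f) :
    ∀ᶠ ε in 𝓝 (0 : ℝ), ∀ s, Integrable (fun l => f s l ε) := by
  obtain ⟨F, hF, hf⟩ := hf
  filter_upwards [hf] with ε hf s
  simp only [hf]
  refine (hF.comp (g := fun l : Fin r → Space p => ((s, l), ε)) (by fun_prop)
    ⟨1, 1, fun l => ?_⟩).integrable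
  simp only [Prod.norm_def, one_mul, pow_one]
  grind [norm_nonneg]

theorem exists_integral (hf : IsLineFunction f) :
    ∃ G : P × ℝ → ℝ, IsSchwartz G ∧ ∀ᶠ ε in 𝓝 (0 : ℝ), ∀ s, ∫ l, f s l ε = G (s, ε) := by
  obtain ⟨F, hF, hf⟩ := hf
  have h : IsSchwartz (fun z : (P × ℝ) × (Fin r → Space p) => F ((z.1.1, z.2), z.1.2)) := by
    refine hF.comp (g := fun z : (P × ℝ) × (Fin r → Space p) => ((z.1.1, z.2), z.1.2))
      (by fun_prop) ⟨1, 1, fun z => ?_⟩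
    simp only [Prod.norm_def, one_mul, pow_one]
    grind
  refine ⟨_, h.integral volume, ?_⟩
  filter_upwards [hf] with ε hf s
  simp only [hf]

theorem contDiffAt (hf : IsLineFunction f) (s : P) :
    ContDiffAt ℝ ∞ (fun ε => ∫ l, f s l ε) 0 := by
  obtain ⟨G, hG, h⟩ := hf.exists_integral
  refine (hG.contDiff_slice s).contDiffAt.congr_of_eventuallyEq ?_
  filter_upwards [h] with ε h using h s

theorem taylorCoeff_isSchwartz (hf : IsLineFunction f) (k : ℕ) :
    IsSchwartz (fun s => taylorCoeff k (fun ε => ∫ l, f s l ε)) := by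
  obtain ⟨G, hG, h⟩ := hf.exists_integral
  refine (hG.taylorCoeff k).congr fun s => taylorCoeff_congr ?_ k
  filter_upwards [h] with ε h using (h s).symm

theorem taylorCoeff_integral_add (hf : IsLineFunction f) (hg : IsLineFunction g) (k : ℕ) (s : P) :
    taylorCoeff k (fun ε => ∫ l, (f s l ε + g s l ε))
      = taylorCoeff k (fun ε => ∫ l, f s l ε) + taylorCoeff k (fun ε => ∫ l, g s l ε) := by
  rw [← taylorCoeff_add (hf.contDiffAt s) (hg.contDiffAt s)]
  refine taylorCoeff_congr ?_ k
  filter_upwards [hf.integrable, hg.integrable] with ε h1 h2 using integral_add (h1 s) (h2 s)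

/-- With k = N and m = N + 1 this discards the Taylor remainders in the Gateaux derivatives and in
the bracket. -/
theorem taylorCoeff_integral_pow_mul (hf : IsLineFunction f) {k m : ℕ} (hkm : k < m) (s : P) :
    taylorCoeff k (fun ε => ∫ l, ε ^ m * f s l ε) = 0 := by
  simp only [integral_const_mul]
  rw [taylorCoeff_pow_mul m (hf.contDiffAt s), if_neg (by omega)]

theorem isLineFunction_deriv {f : ℝ → (Fin r → Space p) → ℝ → ℝ} (hf : IsLineFunction f) :
    IsLineFunction (fun (_ : Unit) l ε => deriv (fun s => f s l ε) 0) := by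
  obtain ⟨F, hF, hf⟩ := hf
  have h1 := hF.fderiv_apply ((1, 0), 0)
  refine ⟨fun z => fderiv ℝ F ((0, z.1.2), z.2) ((1, 0), 0), ?_, ?_⟩
  · refine h1.comp (g := fun z : (Unit × (Fin r → Space p)) × ℝ => ((0, z.1.2), z.2))
      (by fun_prop) ⟨1, 1, fun z => ?_⟩
    have h : ‖z.1.1‖ = 0 := by rw [Subsingleton.elim z.1.1 0, norm_zero]
    simp only [Prod.norm_def z, Prod.norm_def z.1, h, one_mul, pow_one]
    simp only [Prod.norm_def]
    grind [norm_nonneg]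
  · filter_upwards [hf] with ε hf _ l
    simp only [hf]
    have h2 : HasDerivAt (fun s : ℝ => ((s, l), ε)) ((1, 0), 0) 0 :=
      ((hasDerivAt_id 0).prodMk (hasDerivAt_const 0 l)).prodMk (hasDerivAt_const 0 ε)
    exact (((hF.contDiff.differentiable (by simp)) _).hasFDerivAt.comp_hasDerivAt 0 h2).deriv

/-- A variation of the field can be carried out on each line separately: joint Schwartz decay allows
differentiation under the integral, and mixed derivatives commute. -/
theorem hasDerivAt_taylorCoeff {f : ℝ → (Fin r → Space p) → ℝ → ℝ} (hf : IsLineFunction f)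
    (k : ℕ) :
    HasDerivAt (fun s => taylorCoeff k (fun ε => ∫ l, f s l ε))
      (taylorCoeff k (fun ε => ∫ l, deriv (fun s => f s l ε) 0)) 0 := by
  obtain ⟨F, hF, hf⟩ := hf
  have h : IsSchwartz (fun z : (ℝ × ℝ) × (Fin r → Space p) => F ((z.1.1, z.2), z.1.2)) := by
    refine hF.comp (g := fun z : (ℝ × ℝ) × (Fin r → Space p) => ((z.1.1, z.2), z.1.2))
      (by fun_prop) ⟨1, 1, fun z => ?_⟩
    simp only [Prod.norm_def, one_mul, pow_one]
    grind
  have hI := (h.integral volume).hasDerivAt_taylorCoeff k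
  have h1 : (fun s => taylorCoeff k (fun ε => ∫ l, f s l ε))
      = fun s => taylorCoeff k (fun ε => ∫ l, F ((s, l), ε)) := by
    funext s
    refine taylorCoeff_congr ?_ k
    filter_upwards [hf] with ε hf
    simp only [hf]
  have h2 : taylorCoeff k (fun ε => ∫ l, deriv (fun s => f s l ε) 0)
      = taylorCoeff k (fun t => deriv (fun s => ∫ l, F ((s, l), t)) 0) := by
    refine taylorCoeff_congr ?_ k
    filter_upwards [hf] with ε hf
    simp only [hf]
    have h3 : IsSchwartz (fun z : (Fin r → Space p) × ℝ => F ((z.2, z.1), ε)) := by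
      refine hF.comp (g := fun z : (Fin r → Space p) × ℝ => ((z.2, z.1), ε))
        (by fun_prop) ⟨1, 1, fun z => ?_⟩
      simp only [Prod.norm_def, one_mul, pow_one]
      grind [norm_nonneg]
    have h4 := h3.integral_iteratedDeriv volume 1 0
    simp only [iteratedDeriv_one] at h4
    exact h4.symm
  rw [h1, h2]
  exact hI

end IsLineFunction

end LineFamilies

/-! ### Taylor coefficients of families of fields on scale lines -/

section LineCoeff

variable {P : Type} [NormedAddCommGroup P] [NormedSpace ℝ P] {p q N r : ℕ}

/-- The column of the Taylor coefficients at `ε = 0` of a family of fields on scale lines, as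
functions of all the scales. -/
def lineCoeff (N : ℕ) (w : (Fin r → Space p) → ℝ → Field p q) (y : Scales p r) :
    Fin (N + 1) × Fin q → ℝ :=
  fun ia => taylorCoeff ia.1 (fun ε => w (lineLabel ε y) ε (y 0) ia.2)

theorem lineCoeff_congr {w v : (Fin r → Space p) → ℝ → Field p q}
    (h : ∀ᶠ ε in 𝓝 (0 : ℝ), ∀ l, w l ε = v l ε) : lineCoeff N w = lineCoeff N v := by
  funext y ia
  refine taylorCoeff_congr ?_ _
  filter_upwards [h] with ε h
  rw [h]

namespace IsLineFamily

variable {w v : P → (Fin r → Space p) → ℝ → Field p q}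

theorem contDiffAt_along (hw : IsLineFamily w) (s : P) (y : Scales p r) (a : Fin q) :
    ContDiffAt ℝ ∞ (fun ε => w s (lineLabel ε y) ε (y 0) a) 0 := by
  obtain ⟨f, hf, h⟩ := hw.exists_along
  refine ((hf a).contDiff_slice (s, y)).contDiffAt.congr_of_eventuallyEq ?_
  filter_upwards [h] with ε h
  rw [h]

theorem lineCoeff_isSchwartz (hw : IsLineFamily w) :
    IsSchwartz (fun z : P × Scales p r => lineCoeff N (w z.1) z.2) := by
  obtain ⟨f, hf, h⟩ := hw.exists_along
  refine IsSchwartz.pi fun ia => ((hf ia.2).taylorCoeff ia.1).congr fun z => ?_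
  refine taylorCoeff_congr ?_ _
  filter_upwards [h] with ε h
  rw [h]

theorem lineCoeff_isSchwartz_of_unit {w : Unit → (Fin r → Space p) → ℝ → Field p q}
    (hw : IsLineFamily w) : IsSchwartz (lineCoeff N (w ())) := by
  refine (hw.lineCoeff_isSchwartz (N := N)).comp (g := fun y : Scales p r => ((), y))
    (by fun_prop) ⟨1, 1, fun y => ?_⟩
  simp only [Prod.norm_def, one_mul, pow_one]
  grind

theorem lineCoeff_add (hw : IsLineFamily w) (hv : IsLineFamily v) (s : P) :
    lineCoeff N (fun l ε => w s l ε + v s l ε) = lineCoeff N (w s) + lineCoeff N (v s) := by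
  funext y ia
  exact taylorCoeff_add (hw.contDiffAt_along s y ia.2) (hv.contDiffAt_along s y ia.2) _

theorem lineCoeff_smul (c : ℝ) (w : (Fin r → Space p) → ℝ → Field p q) :
    lineCoeff N (fun l ε => c • w l ε) = c • lineCoeff N w := by
  funext y ia
  exact taylorCoeff_const_mul c _ _

theorem lineCoeff_pow_smul (hw : IsLineFamily w) {m : ℕ} (hm : N < m) (s : P) :
    lineCoeff N (fun l ε => ε ^ m • w s l ε) = 0 := by
  funext y ia
  refine (taylorCoeff_pow_mul m (hw.contDiffAt_along s y ia.2) _).trans ?_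
  rw [if_neg (by omega)]
  rfl

/-- Taylor's theorem on scale lines. -/
theorem exists_lineSeries (hw : IsLineFamily w) {Y : P → BigField p q N r}
    (hY : ∀ s, ⇑(Y s) = lineCoeff N (w s)) :
    ∃ R : P → (Fin r → Space p) → ℝ → Field p q, IsLineFamily R ∧ ∀ᶠ ε in 𝓝 (0 : ℝ), ∀ s l,
      w s l ε = MultiScale.lineSeries ε l (Y s) + ε ^ (N + 1) • R s l ε := by
  obtain ⟨χ, hχ, h1⟩ := exists_cutoff isOpen_univ (Set.mem_univ (0 : ℝ))
  have hYs : ∀ ia, IsSchwartz (fun z : P × Scales p r => Y z.1 z.2 ia) := fun ia =>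
    (hw.lineCoeff_isSchwartz.apply ia).congr fun z => by rw [hY]
  obtain ⟨f, hf, hwf⟩ := hw.exists_along
  have hR : ∀ a : Fin q, ∃ R : (P × Scales p r) × ℝ → ℝ, IsSchwartz R ∧ ∀ z, ∀ ε : ℝ, |ε| ≤ 1 →
      f (z, ε) a - ∑ j : Fin (N + 1), ε ^ (j : ℕ) * (Y z.1 z.2 (j, a) * χ ε)
        = ε ^ (N + 1) * R (z, ε) := by
    intro a
    have hT : IsSchwartz (fun z : (P × Scales p r) × ℝ =>
        f z a - ∑ j : Fin (N + 1), z.2 ^ (j : ℕ) * (Y z.1.1 z.1.2 (j, a) * χ z.2)) :=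
      (hf a).sub (IsSchwartz.sum _ fun j _ => ((hYs (j, a)).tensor hχ.isSchwartz).mul
        (c := fun z : (P × Scales p r) × ℝ => z.2 ^ (j : ℕ)) (by fun_prop))
    -- The subtracted polynomial has the coefficients of `f` up to order N by the choice of `Y`; the
    -- cut-off does not alter coefficients at 0.
    refine hT.exists_eq_pow_mul (N + 1) fun k hk z => ?_
    have h2 : (fun ε => f (z, ε) a - ∑ j : Fin (N + 1), ε ^ (j : ℕ) * (Y z.1 z.2 (j, a) * χ ε))
        =ᶠ[𝓝 0] fun ε => f (z, ε) a - ∑ j : Fin (N + 1), ε ^ (j : ℕ) * Y z.1 z.2 (j, a) := by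
      filter_upwards [h1] with ε h1
      simp only [h1, mul_one]
    rw [taylorCoeff_congr h2, taylorCoeff_sub ((hf a).contDiff_slice z).contDiffAt
      (by fun_prop), sub_eq_zero]
    rw [taylorCoeff_polynomial N (fun j => Y z.1 z.2 (j, a)) ⟨k, hk⟩, hY]
    refine taylorCoeff_congr ?_ k
    filter_upwards [hwf] with ε h
    rw [h]
  choose R hRs hR using hR
  -- The division by ε^(N+1) took place at fixed y; its quotient is now restricted to the lines.
  obtain ⟨W, hW, hWR⟩ := exists_schwartzFamily (IsSchwartz.pi fun a => (hRs a).comp_labelLine)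
  refine ⟨fun s l ε => W ((s, l), ε), ⟨W, hW, Filter.Eventually.of_forall fun _ _ _ => rfl⟩, ?_⟩
  filter_upwards [h1, hwf, Metric.closedBall_mem_nhds (0 : ℝ) one_pos] with ε h1 hwf hε s l
  ext x a
  have h3 := hR a (s, labelLine ε l x) ε (by simpa using hε)
  have h4 := congrFun (hwf s (labelLine ε l x)) a
  rw [lineLabel_labelLine, labelLine_zero] at h4
  simp only [h1, mul_one] at h3
  simp only [add_apply, _root_.smul_apply, Pi.add_apply, Pi.smul_apply, smul_eq_mul, hWR,
    lineSeries_apply]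
  rw [h4, ← h3]
  ring

end IsLineFamily

/-- The duality on the perturbed phase space, through the original one on scale lines. -/
theorem pairing_eq_taylorCoeff {w : Unit → (Fin r → Space p) → ℝ → Field p q}
    (hw : IsLineFamily w) {Y : BigField p q N r} (hY : ⇑Y = lineCoeff N (w ()))
    (α : BigField p q N r) :
    pairing α Y = taylorCoeff N (fun ε =>
      ∫ l, pairing (lineSeries ε l (rev α)) (w () l ε)) := by
  obtain ⟨f, hf, hwf⟩ := hw.exists_along
  have hα : ∀ ia, IsSchwartz (fun y => α y ia) := fun ia => (SchwartzMap.isSchwartz α).apply ia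
  have hf' : ∀ a, IsSchwartz (fun z : Scales p r × ℝ => f (((), z.1), z.2) a) := fun a => by
    refine (hf a).comp (g := fun z : Scales p r × ℝ => (((), z.1), z.2)) (by fun_prop)
      ⟨1, 1, fun z => ?_⟩
    simp only [Prod.norm_def, one_mul, pow_one]
    grind
  have hterm : ∀ (a : Fin q) (j : Fin (N + 1)), IsSchwartz (fun z : Scales p r × ℝ =>
      z.2 ^ (j : ℕ) * (α z.1 (j.rev, a) * f (((), z.1), z.2) a)) := fun a j =>
    ((hf' a).mul (c := fun z => α z.1 (j.rev, a))
      ((hα _).hasTemperateGrowth.comp (f := fun z : Scales p r × ℝ => z.1) (by fun_prop))).mul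
      (c := fun z => z.2 ^ (j : ℕ)) (by fun_prop)
  have hF : IsSchwartz (fun z : Scales p r × ℝ => ∑ a, ∑ j : Fin (N + 1),
      z.2 ^ (j : ℕ) * (α z.1 (j.rev, a) * f (((), z.1), z.2) a)) :=
    IsSchwartz.sum _ fun a _ => IsSchwartz.sum _ fun j _ => hterm a j
  -- Integrating along the lines and then over the labels is integrating over all scales, a domain
  -- independent of ε; only then can coefficients be taken under the integral.
  have h1 : (fun ε => ∫ l, pairing (lineSeries ε l (rev α)) (w () l ε)) =ᶠ[𝓝 0]
      fun ε => ∫ y, ∑ a, ∑ j : Fin (N + 1),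
        ε ^ (j : ℕ) * (α y (j.rev, a) * f (((), y), ε) a) := by
    filter_upwards [hwf] with ε hwf
    have hFε : IsSchwartz (fun y : Scales p r => ∑ a, ∑ j : Fin (N + 1),
        ε ^ (j : ℕ) * (α y (j.rev, a) * f (((), y), ε) a)) := hF.slice_snd ε
    rw [← integral_labelLine hFε ε]
    refine integral_congr_ae (Filter.Eventually.of_forall fun l => ?_)
    refine integral_congr_ae (Filter.Eventually.of_forall fun x => ?_)
    have h4 := hwf () (labelLine ε l x)
    rw [lineLabel_labelLine, labelLine_zero] at h4
    simp only [dotProduct, h4, lineSeries_apply, Finset.sum_mul, rev_apply, mul_assoc]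
  rw [taylorCoeff_congr h1, hF.taylorCoeff_integral volume N]
  refine integral_congr_ae (Filter.Eventually.of_forall fun y => ?_)
  have hsm : ∀ a, ContDiffAt ℝ ∞ (fun ε => f (((), y), ε) a) 0 := fun a =>
    ((hf a).contDiff_slice ((), y)).contDiffAt
  simp only
  rw [taylorCoeff_sum _ fun a _ => ContDiffAt.sum fun j _ =>
    ((hterm a j).contDiff_slice y).contDiffAt]
  simp only [dotProduct]
  rw [Fintype.sum_prod_type_right]
  refine Finset.sum_congr rfl fun a _ => ?_
  rw [taylorCoeff_sum _ fun j _ => ((hterm a j).contDiff_slice y).contDiffAt,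
    ← Equiv.sum_comp Fin.revPerm]
  refine Finset.sum_congr rfl fun j _ => ?_
  simp only [Fin.revPerm_apply]
  -- The N-th coefficient of ε^j times a function is its coefficient N - j, which is the component
  -- `j.rev` of `Y`.
  rw [taylorCoeff_pow_mul _ (contDiffAt_const.mul (hsm a)), if_pos (by omega),
    taylorCoeff_const_mul, hY]
  congr 1
  have h2 : ((j.rev : Fin (N + 1)) : ℕ) = N - j := by rw [Fin.val_rev]; omega
  simp only [lineCoeff, h2]
  refine taylorCoeff_congr ?_ _
  filter_upwards [hwf] with ε h
  rw [h]

end LineCoeff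

/-! ### The perturbation vector field and operator -/

section Perturbation

variable {p q N r : ℕ} {I : Set ℝ}

theorem coe_toSchwartz {X ι : Type} [NormedAddCommGroup X] [NormedSpace ℝ X] [Fintype ι]
    {f : X → ι → ℝ} (hf : IsSchwartz f) : ⇑(toSchwartz f) = f := by
  have h : ∃ F : 𝓢(X, ι → ℝ), ⇑F = f := hf
  rw [toSchwartz, dif_pos h]
  exact h.choose_spec

theorem isLineFamily_lineSeries (η : BigField p q N r) :
    IsLineFamily (fun (_ : Unit) l ε => lineSeries ε l η) :=
  IsLineFamily.lineSeries (SchwartzFamily.const η)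

theorem isLineFamily_field (hI : IsOpen I) (h0 : (0 : ℝ) ∈ I)
    {K : ℝ → Field p q → Field p q} (hK : IsSmoothField I K)
    (hr : 0 < r → ∀ ε ∈ I, K ε 0 = 0) (η : BigField p q N r) :
    IsLineFamily (fun (_ : Unit) l ε => K ε (lineSeries ε l η)) :=
  (((isLineFamily_lineSeries η).field hI h0 hK).add (.of_zero hI h0 hK hr)).congr
    (Filter.Eventually.of_forall fun ε _ l => by simp)

theorem perFieldVal_eq (K : ℝ → Field p q → Field p q) (η : BigField p q N r) :
    perFieldVal K η = lineCoeff N (fun l ε => K ε (lineSeries ε l η)) := by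
  funext y ia
  simp only [perFieldVal, lineCoeff]
  congr 1
  funext ε
  rw [fieldAt, uHat_eq_lineSeries]

/-- The Taylor coefficients form a Schwartz function, so the default value of `toSchwartz` does not
occur. -/
theorem coe_perField (hI : IsOpen I) (h0 : (0 : ℝ) ∈ I)
    {K : ℝ → Field p q → Field p q} (hK : IsSmoothField I K)
    (hr : 0 < r → ∀ ε ∈ I, K ε 0 = 0) (η : BigField p q N r) :
    ⇑(perField K η) = lineCoeff N (fun l ε => K ε (lineSeries ε l η)) := by
  rw [← perFieldVal_eq, perField, coe_toSchwartz]
  rw [perFieldVal_eq]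
  exact (isLineFamily_field hI h0 hK hr η).lineCoeff_isSchwartz_of_unit

theorem perFieldDefined (hI : IsOpen I) (h0 : (0 : ℝ) ∈ I)
    {K : ℝ → Field p q → Field p q} (hK : IsSmoothField I K)
    (hr : 0 < r → ∀ ε ∈ I, K ε 0 = 0) : PerFieldDefined N r K where
  smooth η y a := by
    have h := (isLineFamily_field hI h0 hK hr η).contDiffAt_along () y a
    simp only [← uHat_eq_lineSeries] at h
    exact h
  eq η := by rw [coe_perField hI h0 hK hr, perFieldVal_eq]

theorem isSmoothField_perField (hI : IsOpen I) (h0 : (0 : ℝ) ∈ I)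
    {K : ℝ → Field p q → Field p q} (hK : IsSmoothField I K)
    (hr : 0 < r → ∀ ε ∈ I, K ε 0 = 0) :
    IsSmoothField Set.univ (fun _ : ℝ => (perField K : BigField p q N r → BigField p q N r)) where
  zero χ hχ := SchwartzFamily.tensor hχ.isSchwartz _
  family P _ _ _ u hu χ hχ := by
    have hdiff := (IsLineFamily.lineSeries hu).field hI h0 hK
    -- The part coming from `K ε 0` does not depend on the column and cancels in the difference
    -- required by `IsSmoothField`.
    have hsplit : ∀ η : BigField p q N r, ⇑(perField K η)
        = lineCoeff N (fun l ε => K ε (lineSeries ε l η) - K ε 0)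
          + lineCoeff N (fun _ ε => K ε 0) := fun η => by
      rw [coe_perField hI h0 hK hr, ← ((isLineFamily_lineSeries η).field hI h0 hK).lineCoeff_add
        (.of_zero hI h0 hK hr) ()]
      simp only [sub_add_cancel]
    have hzero : ⇑(perField K (0 : BigField p q N r)) = lineCoeff N (fun _ ε => K ε 0) := by
      rw [coe_perField hI h0 hK hr]
      simp only [lineSeries_zero]
    refine (SchwartzFamily.smul (c := fun s : P × ℝ => χ s.2)
      (hχ.isSchwartz.hasTemperateGrowth.comp (by fun_prop)) ?_)
    refine schwartzFamily_iff.2 ((hdiff.lineCoeff_isSchwartz (N := N)).congr fun z => ?_)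
    rw [sub_apply, hsplit, hzero]
    simp

variable {J : ℝ → Field p q → Field p q → Field p q}

/-- By linearity J(û) carries ∑ ε^(N-j) β_j to ∑ ε^(N-j) J(û) β_j, whose coefficient i collects the
coefficients i + j - N. The operator matrix thus becomes the Taylor expansion of J along the lines.
-/
theorem perOperatorVal_eq (hI : IsOpen I) (h0 : (0 : ℝ) ∈ I) (hJ : IsSmoothOperator I J)
    (η β : BigField p q N r) :
    perOperatorVal J η β
      = lineCoeff N (fun l ε => J ε (lineSeries ε l η) (lineSeries ε l (rev β))) := by
  funext y ia
  have hsm : ∀ j, ContDiffAt ℝ ∞ (operatorAt J η β y j ia.2) 0 := fun j => by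
    have h := ((isLineFamily_lineSeries η).operator hI h0 hJ
      (IsLineFamily.lineComponent (SchwartzFamily.const β) j)).contDiffAt_along () y ia.2
    simp only [← uHat_eq_lineSeries, ← lineComponent_eq] at h
    exact h
  have h1 : (fun ε => J ε (lineSeries ε (lineLabel ε y) η)
      (lineSeries ε (lineLabel ε y) (rev β)) (y 0) ia.2) =ᶠ[𝓝 0]
      fun ε => ∑ j : Fin (N + 1), ε ^ (N - j : ℕ) * operatorAt J η β y j ia.2 ε := by
    filter_upwards [hI.mem_nhds h0] with ε hε
    let L : Field p q →ₗ[ℝ] Field p q :=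
      (hJ.linear ε hε (lineSeries ε (lineLabel ε y) η)).mk' _
    have hL : ∀ β, J ε (lineSeries ε (lineLabel ε y) η) β = L β := fun _ => rfl
    rw [lineSeries_rev, hL, map_sum, sum_apply, Finset.sum_apply]
    refine Finset.sum_congr rfl fun j _ => ?_
    rw [map_smul, _root_.smul_apply, Pi.smul_apply, smul_eq_mul, ← hL, ← uHat_eq_lineSeries,
      ← lineComponent_eq]
    rfl
  simp only [lineCoeff]
  rw [taylorCoeff_congr h1, taylorCoeff_sum _ fun (j : Fin (N + 1)) _ =>
    (by fun_prop : ContDiffAt ℝ ∞ (fun ε : ℝ => ε ^ (N - j : ℕ)) 0).mul (hsm j)]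
  refine Finset.sum_congr rfl fun j _ => ?_
  rw [taylorCoeff_pow_mul _ (hsm j)]
  have hj : (j : ℕ) ≤ N := Nat.lt_succ_iff.1 j.2
  by_cases h : N ≤ (ia.1 : ℕ) + j
  · rw [if_pos h, if_pos (by omega)]
    congr 1
    omega
  · rw [if_neg h, if_neg (by omega)]

theorem isLineFamily_operator (hI : IsOpen I) (h0 : (0 : ℝ) ∈ I) (hJ : IsSmoothOperator I J)
    (η β : BigField p q N r) :
    IsLineFamily (fun (_ : Unit) l ε => J ε (lineSeries ε l η) (lineSeries ε l (rev β))) :=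
  (isLineFamily_lineSeries η).operator hI h0 hJ (isLineFamily_lineSeries (rev β))

theorem coe_perOperator (hI : IsOpen I) (h0 : (0 : ℝ) ∈ I) (hJ : IsSmoothOperator I J)
    (η β : BigField p q N r) :
    ⇑(perOperator J η β)
      = lineCoeff N (fun l ε => J ε (lineSeries ε l η) (lineSeries ε l (rev β))) := by
  rw [← perOperatorVal_eq hI h0 hJ, perOperator, coe_toSchwartz]
  rw [perOperatorVal_eq hI h0 hJ]
  exact (isLineFamily_operator hI h0 hJ η β).lineCoeff_isSchwartz_of_unit

theorem perOperatorDefined (hI : IsOpen I) (h0 : (0 : ℝ) ∈ I) (hJ : IsSmoothOperator I J) :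
    PerOperatorDefined N r J where
  smooth η β y j a := by
    have h := ((isLineFamily_lineSeries η).operator hI h0 hJ
      (IsLineFamily.lineComponent (SchwartzFamily.const β) j)).contDiffAt_along () y a
    simp only [← uHat_eq_lineSeries, ← lineComponent_eq] at h
    exact h
  eq η β := by rw [coe_perOperator hI h0 hJ, perOperatorVal_eq hI h0 hJ]

theorem isSmoothOperator_perOperator (hI : IsOpen I) (h0 : (0 : ℝ) ∈ I)
    (hJ : IsSmoothOperator I J) :
    IsSmoothOperator Set.univ
      (fun _ : ℝ => (perOperator J : BigField p q N r → BigField p q N r → _)) where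
  linear _ _ η := by
    constructor
    · intro β γ
      refine DFunLike.coe_injective ?_
      rw [FunLike.coe_add]
      simp only [coe_perOperator hI h0 hJ]
      rw [← (isLineFamily_operator hI h0 hJ η β).lineCoeff_add
        (isLineFamily_operator hI h0 hJ η γ) ()]
      refine lineCoeff_congr ?_
      filter_upwards [hI.mem_nhds h0] with ε hε l
      rw [map_add, lineSeries_add, (hJ.linear ε hε _).map_add]
    · intro c β
      refine DFunLike.coe_injective ?_
      rw [FunLike.coe_smul]
      simp only [coe_perOperator hI h0 hJ]
      rw [← IsLineFamily.lineCoeff_smul]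
      refine lineCoeff_congr ?_
      filter_upwards [hI.mem_nhds h0] with ε hε l
      rw [map_smul, lineSeries_smul, (hJ.linear ε hε _).map_smul]
  family P _ _ _ u α hu hα χ hχ := by
    refine SchwartzFamily.smul (c := fun s : P × ℝ => χ s.2)
      (hχ.isSchwartz.hasTemperateGrowth.comp (by fun_prop)) ?_
    have hα' : SchwartzFamily (fun s => rev (α s)) :=
      schwartzFamily_of_apply fun ia => hα.apply (ia.1.rev, ia.2)
    refine schwartzFamily_iff.2 ((((IsLineFamily.lineSeries hu).operator hI h0 hJ
      (IsLineFamily.lineSeries hα')).lineCoeff_isSchwartz (N := N)).congr fun z => ?_)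
    rw [coe_perOperator hI h0 hJ]

/-- Reduces the pair condition for perturbed operators to the Hamiltonian property of one perturbed
operator. -/
theorem perOperator_comb (hI : IsOpen I) (h0 : (0 : ℝ) ∈ I)
    {L : ℝ → Field p q → Field p q → Field p q} (hJ : IsSmoothOperator I J)
    (hL : IsSmoothOperator I L) (c d : ℝ)
    (hJL : IsSmoothOperator I (fun ε u α => c • J ε u α + d • L ε u α))
    (η β : BigField p q N r) :
    perOperator (fun ε u α => c • J ε u α + d • L ε u α) η β
      = c • perOperator J η β + d • perOperator L η β := by
  refine DFunLike.coe_injective ?_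
  rw [FunLike.coe_add, FunLike.coe_smul, FunLike.coe_smul]
  simp only [coe_perOperator hI h0 hJ, coe_perOperator hI h0 hL, coe_perOperator hI h0 hJL]
  funext y ia
  have h1 := (isLineFamily_operator hI h0 hJ η β).contDiffAt_along () y ia.2
  have h2 := (isLineFamily_operator hI h0 hL η β).contDiffAt_along () y ia.2
  refine (taylorCoeff_add (contDiffAt_const.mul h1) (contDiffAt_const.mul h2) _).trans ?_
  rw [taylorCoeff_const_mul, taylorCoeff_const_mul]
  rfl

end Perturbation

/-! ### Duality and variational derivatives -/

section Duality

variable {X : Type} [NormedAddCommGroup X] [NormedSpace ℝ X] [MeasureSpace X] [BorelSpace X]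
  [SecondCountableTopology X] {ι : Type} [Fintype ι]

omit [BorelSpace X] [SecondCountableTopology X] in
theorem pairing_comm (α β : 𝓢(X, ι → ℝ)) : pairing α β = pairing β α := by
  simp only [pairing, dotProduct_comm]

variable [(volume : Measure X).HasTemperateGrowth]

theorem integrable_dotProduct (α β : 𝓢(X, ι → ℝ)) : Integrable (fun x => α x ⬝ᵥ β x) :=
  (IsSchwartz.sum _ fun a _ => ((SchwartzMap.isSchwartz β).apply a).mul
    ((SchwartzMap.isSchwartz α).apply a).hasTemperateGrowth : IsSchwartz _).integrable

theorem pairing_add_right (α β γ : 𝓢(X, ι → ℝ)) :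
    pairing α (β + γ) = pairing α β + pairing α γ := by
  rw [pairing, pairing, pairing, ← integral_add (integrable_dotProduct α β)
    (integrable_dotProduct α γ)]
  simp only [add_apply, dotProduct_add]

omit [BorelSpace X] [SecondCountableTopology X] [(volume : Measure X).HasTemperateGrowth] in
theorem pairing_smul_right (c : ℝ) (α β : 𝓢(X, ι → ℝ)) :
    pairing α (c • β) = c * pairing α β := by
  rw [pairing, pairing, ← integral_const_mul]
  simp only [smul_apply, dotProduct_smul, smul_eq_mul]

theorem pairing_add_left (α β γ : 𝓢(X, ι → ℝ)) :
    pairing (α + β) γ = pairing α γ + pairing β γ := by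
  rw [pairing_comm, pairing_add_right, pairing_comm γ, pairing_comm γ]

omit [BorelSpace X] [SecondCountableTopology X] [(volume : Measure X).HasTemperateGrowth] in
theorem pairing_smul_left (c : ℝ) (α β : 𝓢(X, ι → ℝ)) :
    pairing (c • α) β = c * pairing α β := by
  rw [pairing_comm, pairing_smul_right, pairing_comm]

theorem eq_zero_of_pairing_self [(volume : Measure X).IsOpenPosMeasure] {α : 𝓢(X, ι → ℝ)}
    (h : pairing α α = 0) : α = 0 := by
  have hc : Continuous (fun x => α x ⬝ᵥ α x) :=
    continuous_finsetSum _ fun a _ => ((continuous_apply a).comp α.continuous).mul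
      ((continuous_apply a).comp α.continuous)
  have h0 : ∀ x, 0 ≤ α x ⬝ᵥ α x := fun x => Finset.sum_nonneg fun a _ => mul_self_nonneg _
  have h1 := (integral_eq_zero_iff_of_nonneg h0 (integrable_dotProduct α α)).1 h
  have h2 := (hc.ae_eq_iff_eq (μ := volume) continuous_zero).1 h1
  ext x a
  have h3 : α x ⬝ᵥ α x = 0 := congrFun h2 x
  rw [dotProduct_self_eq_zero] at h3
  rw [h3]
  rfl

/-- Test both candidates against their own difference. This identifies the chosen `varDeriv` with
any gradient found by computation. -/
theorem IsVarDeriv.unique [(volume : Measure X).IsOpenPosMeasure] {H : 𝓢(X, ι → ℝ) → ℝ}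
    {γ γ' : 𝓢(X, ι → ℝ) → 𝓢(X, ι → ℝ)} (h : IsVarDeriv H γ) (h' : IsVarDeriv H γ') : γ = γ' := by
  funext u
  rw [← sub_eq_zero]
  refine eq_zero_of_pairing_self ?_
  have h1 : pairing (γ u) (γ u - γ' u) = pairing (γ' u) (γ u - γ' u) :=
    (h u _).unique (h' u _)
  have h2 := pairing_add_left (γ u - γ' u) (γ' u) (γ u - γ' u)
  rw [sub_add_cancel, h1] at h2
  linarith

omit [BorelSpace X] [SecondCountableTopology X] [(volume : Measure X).HasTemperateGrowth] in
theorem isVarDeriv_varDeriv {H : 𝓢(X, ι → ℝ) → ℝ} (h : ∃ γ, IsVarDeriv H γ) :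
    IsVarDeriv H (varDeriv H) := by
  rw [varDeriv, dif_pos h]
  exact h.choose_spec

theorem IsVarDeriv.varDeriv_eq [(volume : Measure X).IsOpenPosMeasure] {H : 𝓢(X, ι → ℝ) → ℝ}
    {γ : 𝓢(X, ι → ℝ) → 𝓢(X, ι → ℝ)} (h : IsVarDeriv H γ) : varDeriv H = γ :=
  (isVarDeriv_varDeriv ⟨γ, h⟩).unique h

/-- The Gateaux derivative of an operator is linear in the direction. -/
theorem IsSmoothOperator.gateauxOp_add_smul {I : Set ℝ} (hI : IsOpen I)
    {J : ℝ → 𝓢(X, ι → ℝ) → 𝓢(X, ι → ℝ) → 𝓢(X, ι → ℝ)} (hJ : IsSmoothOperator I J) {ε : ℝ}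
    (hε : ε ∈ I) (u Y Z α γ : 𝓢(X, ι → ℝ)) (c : ℝ) :
    gateauxOp (J ε) u (Y + c • Z) α γ = gateauxOp (J ε) u Y α γ + c * gateauxOp (J ε) u Z α γ := by
  obtain ⟨χ, hχ, h1⟩ := exists_cutoff hI hε
  -- Linearity in the direction is differentiability of (a, b) ↦ ⟨α, J(u + aY + bZ) γ⟩ at 0. The
  -- bump makes the affine family Schwartz in a, b and ε, as the smoothness hypothesis requires.
  let φ : ContDiffBump (((0, 0), ε) : (ℝ × ℝ) × ℝ) := ⟨1, 2, one_pos, one_lt_two⟩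
  have hφ : IsSchwartz φ := .of_hasCompactSupport φ.hasCompactSupport φ.contDiff
  have hφY : IsSchwartz (fun s => s.1.1 * φ s) := hφ.mul (by fun_prop)
  have hφZ : IsSchwartz (fun s => s.1.2 * φ s) := hφ.mul (by fun_prop)
  have hu : SchwartzFamily (fun s => φ s • u + (s.1.1 * φ s) • Y + (s.1.2 * φ s) • Z) :=
    ((SchwartzFamily.tensor hφ u).add (SchwartzFamily.tensor hφY Y)).add
      (SchwartzFamily.tensor hφZ Z)
  have hG := (SchwartzFamily.tensor hφ α).pairing
    (hJ.family (ℝ × ℝ) _ _ hu (SchwartzFamily.tensor hφ γ) χ hχ)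
  let g : ℝ × ℝ → ℝ := fun s => pairing α (J ε (u + s.1 • Y + s.2 • Z) γ)
  have hg : DifferentiableAt ℝ g 0 := by
    have h2 : DifferentiableAt ℝ (fun s : ℝ × ℝ => pairing (φ (s, ε) • α) (χ ε •
        J ε (φ (s, ε) • u + (s.1 * φ (s, ε)) • Y + (s.2 * φ (s, ε)) • Z) (φ (s, ε) • γ))) 0 :=
      (hG.contDiff.comp (f := fun s : ℝ × ℝ => (s, ε)) (by fun_prop)).differentiable (by simp) 0
    refine h2.congr_of_eventuallyEq ?_
    have h3 : Filter.Tendsto (fun s : ℝ × ℝ => (s, ε)) (𝓝 0) (𝓝 ((0, 0), ε)) :=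
      Continuous.tendsto' (by fun_prop) _ _ rfl
    filter_upwards [h3.eventually φ.eventuallyEq_one] with s hs
    have hs' : φ (s, ε) = 1 := hs
    simp only [g, hs', h1.self_of_nhds, one_smul, mul_one]
  -- By the chain rule each directional derivative is a value of one linear map, evaluated below at
  -- (1, c), (1, 0) and (0, 1).
  have hline : ∀ a b : ℝ, gateauxOp (J ε) u (a • Y + b • Z) α γ = fderiv ℝ g 0 (a, b) := by
    intro a b
    have h2 : HasDerivAt (fun δ : ℝ => (δ * a, δ * b)) (a, b) 0 := by
      simpa using ((hasDerivAt_id (0 : ℝ)).mul_const a).prodMk ((hasDerivAt_id (0 : ℝ)).mul_const b)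
    have h3 : HasFDerivAt g (fderiv ℝ g 0) ((fun δ : ℝ => (δ * a, δ * b)) 0) := by
      have h00 : (fun δ : ℝ => (δ * a, δ * b)) 0 = 0 := by simp
      rw [h00]
      exact hg.hasFDerivAt
    have h4 := (h3.comp_hasDerivAt 0 h2).deriv
    rw [← h4, gateauxOp]
    congr 1
    funext δ
    simp only [g, Function.comp_apply, smul_add, smul_smul, add_assoc]
  have e1 := hline 1 c
  have e2 := hline 1 0
  have e3 := hline 0 1
  simp only [one_smul, zero_smul, add_zero, zero_add] at e1 e2 e3
  rw [e1, e2, e3, ← smul_eq_mul, ← map_smul, ← map_add]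
  simp

end Duality

/-! ### The perturbation functional -/

section Functional

variable {p q N r : ℕ} {I : Set ℝ}

theorem pairing_rev (α β : BigField p q N r) : pairing (rev α) β = pairing α (rev β) := by
  simp only [pairing, dotProduct, rev_apply]
  congr 1
  funext y
  exact Fintype.sum_equiv ((Equiv.prodCongr Fin.revPerm (Equiv.refl _))) _ _ fun ⟨j, a⟩ => by simp

/-- A cut-off function on the line of a deformation parameter. -/
theorem exists_bump : ∃ φ : ℝ → ℝ, IsSchwartz φ ∧ ∀ᶠ δ in 𝓝 (0 : ℝ), φ δ = 1 := by
  obtain ⟨φ, hφ, h1⟩ := exists_cutoff isOpen_univ (Set.mem_univ (0 : ℝ))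
  exact ⟨φ, hφ.isSchwartz, h1⟩

/-- Where φ = 1 this is the straight deformation w + δ v; the factor φ provides the decay in δ and
leaves derivatives at δ = 0 unchanged. -/
theorem IsLineFamily.deformation {φ : ℝ → ℝ} (hφ : IsSchwartz φ)
    {w v : Unit → (Fin r → Space p) → ℝ → Field p q} (hw : IsLineFamily w) (hv : IsLineFamily v) :
    IsLineFamily (fun (δ : ℝ) l ε => φ δ • w () l ε + (δ * φ δ) • v () l ε) :=
  (IsLineFamily.tensor hφ hw).add (IsLineFamily.tensor (hφ.mul (by fun_prop)) hv)

variable {H : ℝ → Field p q → ℝ}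

theorem isLineFunction_functional (hI : IsOpen I) (h0 : (0 : ℝ) ∈ I)
    (hH : IsSmoothFunction I H) (hr : 0 < r → ∀ ε ∈ I, H ε 0 = 0) (η : BigField p q N r) :
    IsLineFunction (fun (_ : Unit) l ε => H ε (lineSeries ε l η)) :=
  ((IsLineFunction.function hI h0 hH (isLineFamily_lineSeries η)).add
    (.of_zero hI h0 hH hr)).congr (Filter.Eventually.of_forall fun ε _ l => by simp)

theorem perFunctionalDefined_of_isLineFunction
    (h : ∀ η : BigField p q N r, IsLineFunction (fun (_ : Unit) l ε => H ε (lineSeries ε l η))) :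
    PerFunctionalDefined N r H where
  integrable η := (h η).integrable.mono fun _ hε => hε ()
  smooth η := (h η).contDiffAt ()

theorem perFunctional_eq (hI : IsOpen I) (h0 : (0 : ℝ) ∈ I)
    (hH : IsSmoothFunction I H) (hr : 0 < r → ∀ ε ∈ I, H ε 0 = 0) (η : BigField p q N r) :
    perFunctional H η = taylorCoeff N (fun ε => ∫ l, (H ε (lineSeries ε l η) - H ε 0))
      + perFunctional H (0 : BigField p q N r) := by
  have h := IsLineFunction.taylorCoeff_integral_add
    (IsLineFunction.function hI h0 hH (isLineFamily_lineSeries η)) (.of_zero hI h0 hH hr) N ()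
  simp only [sub_add_cancel] at h
  have h2 : perFunctional H (0 : BigField p q N r)
      = taylorCoeff N (fun ε => ∫ _ : Fin r → Space p, H ε 0) := by
    have h3 : ∀ (ε : ℝ) (l : Fin r → Space p),
        functionalAt H (0 : BigField p q N r) ε l = H ε 0 := fun ε l =>
      congrArg (H ε) (lineSeries_zero ε l)
    simp only [perFunctional, h3]
  rw [h2]
  exact h

theorem isSmoothFunction_perFunctional (hI : IsOpen I) (h0 : (0 : ℝ) ∈ I)
    (hH : IsSmoothFunction I H) (hr : 0 < r → ∀ ε ∈ I, H ε 0 = 0) :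
    IsSmoothFunction Set.univ (fun _ : ℝ => (perFunctional H : BigField p q N r → ℝ)) where
  zero χ hχ := hχ.smooth.mul contDiff_const
  family P _ _ _ u hu χ hχ := by
    obtain ⟨F, hF⟩ := ((IsLineFunction.function hI h0 hH
      (IsLineFamily.lineSeries hu)).taylorCoeff_isSchwartz N).mul
      (c := fun s : P × ℝ => χ s.2) (hχ.isSchwartz.hasTemperateGrowth.comp (by fun_prop))
    refine ⟨F, fun s => (congrFun hF s).trans ?_⟩
    rw [perFunctional_eq hI h0 hH hr, add_sub_cancel_right]

/-- On each line the variation of H(û) is the pairing of δH/δu(û) with the series of `K`. Its N-th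
coefficient is a pairing by `pairing_eq_taylorCoeff`, and the reversal appears because η_j enters
with weight ε^j and so meets the gradient coefficient N - j. -/
theorem isVarDeriv_perFunctional (hI : IsOpen I) (h0 : (0 : ℝ) ∈ I) (hH : IsFunctional I H)
    (hr : AdmitsScales r I H) :
    IsVarDeriv (perFunctional H : BigField p q N r → ℝ)
      (fun η => rev (perField (fun ε => varDeriv (H ε)) η)) := by
  intro η K
  have hr1 : 0 < r → ∀ ε ∈ I, H ε 0 = 0 := fun h ε hε => (hr h ε hε).1
  have hr2 : 0 < r → ∀ ε ∈ I, varDeriv (H ε) 0 = 0 := fun h ε hε => (hr h ε hε).2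
  obtain ⟨φ, hφ, hφ1⟩ := exists_bump
  have hf := IsLineFunction.function hI h0 hH.smooth (IsLineFamily.deformation hφ
    (isLineFamily_lineSeries η) (isLineFamily_lineSeries K))
  have hd := (hf.hasDerivAt_taylorCoeff N).add_const (perFunctional H (0 : BigField p q N r))
  have h1 : (fun δ : ℝ => perFunctional H (η + δ • K)) =ᶠ[𝓝 0] fun δ =>
      taylorCoeff N (fun ε => ∫ l, (H ε (φ δ • lineSeries ε l η + (δ * φ δ) • lineSeries ε l K)
        - H ε 0)) + perFunctional H (0 : BigField p q N r) := by
    filter_upwards [hφ1] with δ hδ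
    rw [perFunctional_eq hI h0 hH.smooth hr1]
    simp only [hδ, one_smul, mul_one, lineSeries_add, lineSeries_smul]
  have h2 : pairing (rev (perField (fun ε => varDeriv (H ε)) η)) K = taylorCoeff N (fun ε =>
      ∫ l, deriv (fun δ => H ε (φ δ • lineSeries ε l η + (δ * φ δ) • lineSeries ε l K)
        - H ε 0) 0) := by
    rw [pairing_rev, pairing_comm, pairing_eq_taylorCoeff
      (isLineFamily_field hI h0 hH.smooth_varDeriv hr2 η)
      (coe_perField hI h0 hH.smooth_varDeriv hr2 η), rev_rev]
    refine taylorCoeff_congr ?_ N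
    filter_upwards [hI.mem_nhds h0] with ε hε
    refine integral_congr_ae (Filter.Eventually.of_forall fun l => ?_)
    have h3 := isVarDeriv_varDeriv (hH.exists_varDeriv ε hε) (lineSeries ε l η) (lineSeries ε l K)
    have h4 : (fun δ => H ε (φ δ • lineSeries ε l η + (δ * φ δ) • lineSeries ε l K) - H ε 0)
        =ᶠ[𝓝 0] fun δ => H ε (lineSeries ε l η + δ • lineSeries ε l K) - H ε 0 := by
      filter_upwards [hφ1] with δ hδ
      simp only [hδ, one_smul, mul_one]
    simp only
    rw [h4.deriv_eq, (h3.sub_const _).deriv, pairing_comm]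
  rw [h2]
  exact hd.congr_of_eventuallyEq h1

theorem varDeriv_perFunctional (hI : IsOpen I) (h0 : (0 : ℝ) ∈ I) (hH : IsFunctional I H)
    (hr : AdmitsScales r I H) :
    varDeriv (perFunctional H : BigField p q N r → ℝ)
      = fun η => rev (perField (fun ε => varDeriv (H ε)) η) :=
  (isVarDeriv_perFunctional hI h0 hH hr).varDeriv_eq

theorem isFunctional_perFunctional (hI : IsOpen I) (h0 : (0 : ℝ) ∈ I) (hH : IsFunctional I H)
    (hr : AdmitsScales r I H) :
    IsFunctional Set.univ (fun _ : ℝ => (perFunctional H : BigField p q N r → ℝ)) where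
  smooth := isSmoothFunction_perFunctional hI h0 hH.smooth fun h ε hε => (hr h ε hε).1
  exists_varDeriv _ _ := ⟨_, isVarDeriv_perFunctional hI h0 hH hr⟩
  smooth_varDeriv := by
    have hK := isSmoothField_perField (N := N) (r := r) hI h0 hH.smooth_varDeriv
      fun h ε hε => (hr h ε hε).2
    simp only [varDeriv_perFunctional hI h0 hH hr]
    constructor
    · intro χ hχ
      exact SchwartzFamily.tensor hχ.isSchwartz _
    · intro P _ _ _ u hu χ hχ
      exact schwartzFamily_of_apply fun ja =>
        (hK.family P u hu χ hχ).apply (ja.1.rev, ja.2)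

/-! ### The Hamiltonian property -/

variable {J : ℝ → Field p q → Field p q → Field p q}

section Gateaux

variable {w z a c : Unit → (Fin r → Space p) → ℝ → Field p q}

theorem isLineFunction_deformation (hI : IsOpen I) (h0 : (0 : ℝ) ∈ I) (hJ : IsSmoothOperator I J)
    {φ : ℝ → ℝ} (hφ : IsSchwartz φ) (hw : IsLineFamily w)
    (hz : IsLineFamily z) (ha : IsLineFamily a) (hc : IsLineFamily c) :
    IsLineFunction (fun (δ : ℝ) l ε => pairing (φ δ • a () l ε)
      (J ε (φ δ • w () l ε + (δ * φ δ) • z () l ε) (φ δ • c () l ε))) :=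
  IsLineFunction.pairing (IsLineFamily.tensor hφ ha) ((IsLineFamily.deformation hφ hw hz).operator
    hI h0 hJ (IsLineFamily.tensor hφ hc))

theorem deriv_deformation {φ : ℝ → ℝ} (hφ1 : ∀ᶠ δ in 𝓝 (0 : ℝ), φ δ = 1)
    (L : Field p q → Field p q → Field p q) (u Y α γ : Field p q) :
    deriv (fun δ => pairing (φ δ • α) (L (φ δ • u + (δ * φ δ) • Y) (φ δ • γ))) 0
      = gateauxOp L u Y α γ := by
  refine Filter.EventuallyEq.deriv_eq ?_
  filter_upwards [hφ1] with δ hδ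
  simp only [hδ, one_smul, mul_one]

theorem isLineFunction_gateauxOp (hI : IsOpen I) (h0 : (0 : ℝ) ∈ I) (hJ : IsSmoothOperator I J)
    (hw : IsLineFamily w) (hz : IsLineFamily z) (ha : IsLineFamily a) (hc : IsLineFamily c) :
    IsLineFunction (fun (_ : Unit) l ε =>
      gateauxOp (J ε) (w () l ε) (z () l ε) (a () l ε) (c () l ε)) := by
  obtain ⟨φ, hφ, hφ1⟩ := exists_bump
  have h := (isLineFunction_deformation hI h0 hJ hφ hw hz ha hc).isLineFunction_deriv
  simpa only [deriv_deformation hφ1] using h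

end Gateaux

/-- The Gateaux derivative of the perturbation operator, through that of the original one. -/
theorem gateauxOp_perOperator (hI : IsOpen I) (h0 : (0 : ℝ) ∈ I) (hJ : IsSmoothOperator I J)
    (η Y α γ : BigField p q N r) :
    gateauxOp (perOperator J) η Y α γ = taylorCoeff N (fun ε => ∫ l, gateauxOp (J ε)
      (lineSeries ε l η) (lineSeries ε l Y) (lineSeries ε l (rev α)) (lineSeries ε l (rev γ))) := by
  obtain ⟨φ, hφ, hφ1⟩ := exists_bump
  have h := ((isLineFunction_deformation hI h0 hJ hφ (isLineFamily_lineSeries η)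
    (isLineFamily_lineSeries Y) (isLineFamily_lineSeries (rev α))
    (isLineFamily_lineSeries (rev γ))).hasDerivAt_taylorCoeff N).deriv
  simp only [deriv_deformation hφ1] at h
  rw [← h, gateauxOp]
  refine Filter.EventuallyEq.deriv_eq ?_
  filter_upwards [hφ1] with δ hδ
  rw [pairing_eq_taylorCoeff (isLineFamily_operator hI h0 hJ (η + δ • Y) γ)
    (coe_perOperator hI h0 hJ _ _)]
  simp only [hδ, one_smul, mul_one, lineSeries_add, lineSeries_smul]

/-- The direction matters only modulo ε^(N+1), by linearity in it. This is needed because Ĵ_N β is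
merely the truncation of J(û) applied to the series of `rev β`. -/
theorem gateauxOp_perOperator_field (hI : IsOpen I) (h0 : (0 : ℝ) ∈ I) (hJ : IsSmoothOperator I J)
    (η α γ : BigField p q N r) {w : Unit → (Fin r → Space p) → ℝ → Field p q}
    (hw : IsLineFamily w) {Y : BigField p q N r} (hY : ⇑Y = lineCoeff N (w ())) :
    gateauxOp (perOperator J) η Y α γ = taylorCoeff N (fun ε => ∫ l, gateauxOp (J ε)
      (lineSeries ε l η) (w () l ε) (lineSeries ε l (rev α)) (lineSeries ε l (rev γ))) := by
  obtain ⟨R, hR, h⟩ := hw.exists_lineSeries (Y := fun _ => Y) fun _ => hY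
  have hη := isLineFamily_lineSeries η
  have hα := isLineFamily_lineSeries (rev α)
  have hγ := isLineFamily_lineSeries (rev γ)
  have h1 := isLineFunction_gateauxOp hI h0 hJ hη (isLineFamily_lineSeries Y) hα hγ
  have h2 := isLineFunction_gateauxOp hI h0 hJ hη hR hα hγ
  have h3 : IsLineFunction (fun (_ : Unit) l ε => ε ^ (N + 1) * gateauxOp (J ε)
      (lineSeries ε l η) (R () l ε) (lineSeries ε l (rev α)) (lineSeries ε l (rev γ))) := by
    obtain ⟨F, hF, h⟩ := h2
    refine ⟨_, hF.mul (c := fun s => s.2 ^ (N + 1)) (by fun_prop), ?_⟩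
    filter_upwards [h] with ε h s l
    rw [h s]
  have h4 := h1.taylorCoeff_integral_add h3 N ()
  rw [h2.taylorCoeff_integral_pow_mul (Nat.lt_succ_self N) (), add_zero] at h4
  rw [gateauxOp_perOperator hI h0 hJ, ← h4]
  refine taylorCoeff_congr ?_ N
  filter_upwards [h, hI.mem_nhds h0] with ε h hε
  simp only [h, hJ.gateauxOp_add_smul hI hε]

theorem perOperator_skew (hI : IsOpen I) (h0 : (0 : ℝ) ∈ I) (hJ : IsHamiltonianOp I J)
    (η α β : BigField p q N r) :
    pairing α (perOperator J η β) + pairing β (perOperator J η α) = 0 := by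
  have h1 := fun α β : BigField p q N r => IsLineFunction.pairing (isLineFamily_lineSeries (rev α))
    (isLineFamily_operator hI h0 hJ.smooth η β)
  have h2 := fun α β : BigField p q N r => pairing_eq_taylorCoeff (isLineFamily_operator hI h0 hJ.smooth η β)
    (coe_perOperator hI h0 hJ.smooth η β) α
  rw [h2 α β, h2 β α, ← (h1 α β).taylorCoeff_integral_add (h1 β α) N (), ← taylorCoeff_zero_fun N]
  refine taylorCoeff_congr ?_ N
  filter_upwards [hI.mem_nhds h0] with ε hε
  simp only [hJ.skew ε hε, integral_zero]

/-- The cyclic sum is the N-th coefficient of an integral over the lines whose integrand is the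
Jacobi sum of J at û, with the series of the reversed covectors; it vanishes for ε in `I`. -/
theorem perOperator_jacobi (hI : IsOpen I) (h0 : (0 : ℝ) ∈ I) (hJ : IsHamiltonianOp I J)
    (η α β γ : BigField p q N r) :
    gateauxOp (perOperator J) η (perOperator J η β) α γ
      + gateauxOp (perOperator J) η (perOperator J η γ) β α
      + gateauxOp (perOperator J) η (perOperator J η α) γ β = 0 := by
  have hg : ∀ α β γ : BigField p q N r, IsLineFunction (fun (_ : Unit) l ε => gateauxOp (J ε)
      (lineSeries ε l η) (J ε (lineSeries ε l η) (lineSeries ε l (rev β)))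
      (lineSeries ε l (rev α)) (lineSeries ε l (rev γ))) := fun α β γ => by
    have h := isLineFunction_gateauxOp hI h0 hJ.smooth (isLineFamily_lineSeries η)
      (isLineFamily_operator hI h0 hJ.smooth η β) (isLineFamily_lineSeries (rev α))
      (isLineFamily_lineSeries (rev γ))
    exact h
  have hp : ∀ α β γ : BigField p q N r, gateauxOp (perOperator J) η (perOperator J η β) α γ
      = taylorCoeff N (fun ε => ∫ l, gateauxOp (J ε)
      (lineSeries ε l η) (J ε (lineSeries ε l η) (lineSeries ε l (rev β)))
      (lineSeries ε l (rev α)) (lineSeries ε l (rev γ))) := fun α β γ =>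
    gateauxOp_perOperator_field
      (w := fun (_ : Unit) l ε => J ε (lineSeries ε l η) (lineSeries ε l (rev β)))
      hI h0 hJ.smooth η α γ (isLineFamily_operator hI h0 hJ.smooth η β)
      (coe_perOperator hI h0 hJ.smooth η β)
  rw [hp α β γ, hp β γ α, hp γ α β, ← (hg α β γ).taylorCoeff_integral_add (hg β γ α) N (),
    ← ((hg α β γ).add (hg β γ α)).taylorCoeff_integral_add (hg γ α β) N (),
    ← taylorCoeff_zero_fun N]
  refine taylorCoeff_congr ?_ N
  filter_upwards [hI.mem_nhds h0] with ε hε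
  simp only [hJ.jacobi ε hε, integral_zero]

theorem isHamiltonianOp_perOperator (hI : IsOpen I) (h0 : (0 : ℝ) ∈ I) (hJ : IsHamiltonianOp I J) :
    IsHamiltonianOp Set.univ
      (fun _ : ℝ => (perOperator J : BigField p q N r → BigField p q N r → _)) where
  smooth := isSmoothOperator_perOperator hI h0 hJ.smooth
  skew _ _ := perOperator_skew hI h0 hJ
  jacobi _ _ := perOperator_jacobi hI h0 hJ

/-! ### Poisson brackets and Hamiltonian formulations. -/

/-- The perturbation operator applied to a perturbed covector field. -/
theorem perOperator_rev_perField (hI : IsOpen I) (h0 : (0 : ℝ) ∈ I) (hJ : IsSmoothOperator I J)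
    {G : ℝ → Field p q → Field p q} (hG : IsSmoothField I G)
    (hr : 0 < r → ∀ ε ∈ I, G ε 0 = 0) (η : BigField p q N r) :
    ⇑(perOperator J η (rev (perField G η)))
      = lineCoeff N (fun l ε => J ε (lineSeries ε l η) (G ε (lineSeries ε l η))) := by
  have hη := isLineFamily_lineSeries η
  -- The two reversals cancel, so J(û) acts on the Taylor polynomial of G(û); the remainder, of
  -- order N + 1, affects none of the coefficients 0, …, N.
  obtain ⟨R, hR, h⟩ := (isLineFamily_field hI h0 hG hr η).exists_lineSeries
    (Y := fun _ => perField G η) fun _ => coe_perField hI h0 hG hr η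
  have h1 := (hη.operator hI h0 hJ (isLineFamily_lineSeries (perField G η)))
  have h2 := hη.operator hI h0 hJ hR
  have h3 := h1.lineCoeff_add (N := N) (h2.pow_smul (N + 1)) ()
  rw [h2.lineCoeff_pow_smul (Nat.lt_succ_self N), add_zero] at h3
  rw [coe_perOperator hI h0 hJ, rev_rev, ← h3]
  refine lineCoeff_congr ?_
  filter_upwards [h, hI.mem_nhds h0] with ε h hε l
  rw [h () l, (hJ.linear ε hε _).map_add, (hJ.linear ε hε _).map_smul]

/-- By the duality formula the left side is the N-th coefficient of the bracket on the lines with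
the first gradient truncated; restoring the full gradient costs a multiple of ε^(N+1). -/
theorem bracket_perFunctional (hI : IsOpen I) (h0 : (0 : ℝ) ∈ I) (hJ : IsSmoothOperator I J)
    {H₁ H₂ : ℝ → Field p q → ℝ} (h₁ : IsFunctional I H₁) (h₂ : IsFunctional I H₂)
    (hr₁ : AdmitsScales r I H₁) (hr₂ : AdmitsScales r I H₂) (η : BigField p q N r) :
    bracket (perOperator J) (perFunctional H₁) (perFunctional H₂) η
      = perFunctional (fun ε => bracket (J ε) (H₁ ε) (H₂ ε)) η := by
  have hz₁ : 0 < r → ∀ ε ∈ I, varDeriv (H₁ ε) 0 = 0 := fun h ε hε => (hr₁ h ε hε).2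
  have hz₂ : 0 < r → ∀ ε ∈ I, varDeriv (H₂ ε) 0 = 0 := fun h ε hε => (hr₂ h ε hε).2
  have hf₂ := isLineFamily_field hI h0 h₂.smooth_varDeriv hz₂ η
  have hop := (isLineFamily_lineSeries η).operator hI h0 hJ hf₂
  obtain ⟨R, hR, h⟩ := (isLineFamily_field hI h0 h₁.smooth_varDeriv hz₁ η).exists_lineSeries
    (Y := fun _ => perField (fun ε => varDeriv (H₁ ε)) η)
    fun _ => coe_perField hI h0 h₁.smooth_varDeriv hz₁ η
  have hp := IsLineFunction.pairing
    (isLineFamily_lineSeries (perField (fun ε => varDeriv (H₁ ε)) η)) hop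
  have hpR := IsLineFunction.pairing hR hop
  have hpR' : IsLineFunction (fun (_ : Unit) l ε => ε ^ (N + 1) * pairing (R () l ε)
      (J ε (lineSeries ε l η) (varDeriv (H₂ ε) (lineSeries ε l η)))) := by
    simpa only [pairing_smul_left] using IsLineFunction.pairing (hR.pow_smul (N + 1)) hop
  have h3 := hp.taylorCoeff_integral_add hpR' N ()
  rw [hpR.taylorCoeff_integral_pow_mul (Nat.lt_succ_self N) (), add_zero] at h3
  rw [bracket, varDeriv_perFunctional hI h0 h₁ hr₁, varDeriv_perFunctional hI h0 h₂ hr₂,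
    pairing_eq_taylorCoeff hop
      (perOperator_rev_perField hI h0 hJ h₂.smooth_varDeriv hz₂ η), rev_rev, ← h3, perFunctional]
  refine taylorCoeff_congr ?_ N
  filter_upwards [h] with ε h
  refine integral_congr_ae (Filter.Eventually.of_forall fun l => ?_)
  have h4 : functionalAt (fun ε => bracket (J ε) (H₁ ε) (H₂ ε)) η ε l
      = pairing (varDeriv (H₁ ε) (lineSeries ε l η))
        (J ε (lineSeries ε l η) (varDeriv (H₂ ε) (lineSeries ε l η))) := rfl
  simp only
  rw [h4, h () l, pairing_add_left, pairing_smul_left]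

theorem perFunctionalDefined_bracket (hI : IsOpen I) (h0 : (0 : ℝ) ∈ I)
    (hJ : IsSmoothOperator I J) {H₁ H₂ : ℝ → Field p q → ℝ} (h₁ : IsFunctional I H₁)
    (h₂ : IsFunctional I H₂) (hr₁ : AdmitsScales r I H₁) (hr₂ : AdmitsScales r I H₂) :
    PerFunctionalDefined N r (fun ε => bracket (J ε) (H₁ ε) (H₂ ε)) :=
  perFunctionalDefined_of_isLineFunction fun η => IsLineFunction.pairing
    (isLineFamily_field hI h0 h₁.smooth_varDeriv (fun h ε hε => (hr₁ h ε hε).2) η)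
    ((isLineFamily_lineSeries η).operator hI h0 hJ
      (isLineFamily_field hI h0 h₂.smooth_varDeriv (fun h ε hε => (hr₂ h ε hε).2) η))

theorem IsFunctional.perFunctionalDefined (hI : IsOpen I) (h0 : (0 : ℝ) ∈ I)
    (hH : IsFunctional I H) (hr : AdmitsScales r I H) : PerFunctionalDefined N r H :=
  perFunctionalDefined_of_isLineFunction fun η =>
    isLineFunction_functional hI h0 hH.smooth (fun h ε hε => (hr h ε hε).1) η

/-- The decay condition on `K` is inherited from the gradient of `H`, since J is linear. -/
theorem IsHamiltonianFormulation.field_zero {K : ℝ → Field p q → Field p q}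
    (h : IsHamiltonianFormulation I K J H) (hr : AdmitsScales r I H) :
    0 < r → ∀ ε ∈ I, K ε 0 = 0 := fun hr' ε hε => by
  rw [h.eq ε hε, (hr hr' ε hε).2, (h.operator.smooth.linear ε hε 0).map_zero]

theorem IsHamiltonianFormulation.perturbation (hI : IsOpen I) (h0 : (0 : ℝ) ∈ I)
    {K : ℝ → Field p q → Field p q} (h : IsHamiltonianFormulation I K J H)
    (hr : AdmitsScales r I H) :
    IsHamiltonianFormulation Set.univ
      (fun _ : ℝ => (perField K : BigField p q N r → BigField p q N r))
      (fun _ : ℝ => perOperator J) (fun _ : ℝ => perFunctional H) where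
  field := isSmoothField_perField hI h0 h.field (h.field_zero hr)
  operator := isHamiltonianOp_perOperator hI h0 h.operator
  functional := isFunctional_perFunctional hI h0 h.functional hr
  eq _ _ η := by
    refine DFunLike.coe_injective ?_
    rw [varDeriv_perFunctional hI h0 h.functional hr, perOperator_rev_perField hI h0
      h.operator.smooth h.functional.smooth_varDeriv (fun h ε hε => (hr h ε hε).2),
      coe_perField hI h0 h.field (h.field_zero hr)]
    refine lineCoeff_congr ?_
    filter_upwards [hI.mem_nhds h0] with ε hε l
    rw [h.eq ε hε]

end Functional

end MultiScale

end

/-! ### The theorem. -/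

open MultiScale

theorem theorem2p8 (p q N r : ℕ) (I : Set ℝ) (hI : IsOpen I) (h0 : (0 : ℝ) ∈ I)
    (K : ℝ → Field p q → Field p q) (hK : IsSmoothField I K) :
    -- the Hamiltonian formulation of the perturbation system
    (∀ (J : ℝ → Field p q → Field p q → Field p q) (H : ℝ → Field p q → ℝ),
      IsHamiltonianFormulation I K J H → AdmitsScales r I H →
        PerFieldDefined N r K ∧ PerOperatorDefined N r J ∧ PerFunctionalDefined N r H ∧
        IsHamiltonianFormulation Set.univ
          (fun _ : ℝ => (perField K : BigField p q N r → BigField p q N r))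
          (fun _ : ℝ => perOperator J) (fun _ : ℝ => perFunctional H)) ∧
    -- the Poisson brackets
    (∀ (J : ℝ → Field p q → Field p q → Field p q) (H₁ H₂ : ℝ → Field p q → ℝ),
      IsHamiltonianOp I J → IsFunctional I H₁ → IsFunctional I H₂ →
      AdmitsScales r I H₁ → AdmitsScales r I H₂ →
        PerFunctionalDefined N r H₁ ∧ PerFunctionalDefined N r H₂ ∧
        IsFunctional Set.univ
          (fun _ : ℝ => (perFunctional H₁ : BigField p q N r → ℝ)) ∧
        IsFunctional Set.univ
          (fun _ : ℝ => (perFunctional H₂ : BigField p q N r → ℝ)) ∧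
        PerOperatorDefined N r J ∧
        IsHamiltonianOp Set.univ
          (fun _ : ℝ => (perOperator J : BigField p q N r → BigField p q N r → _)) ∧
        PerFunctionalDefined N r (fun ε => bracket (J ε) (H₁ ε) (H₂ ε)) ∧
        ∀ η : BigField p q N r,
          bracket (perOperator J) (perFunctional H₁) (perFunctional H₂) η
            = perFunctional (fun ε => bracket (J ε) (H₁ ε) (H₂ ε)) η) ∧
    -- the multi-Hamiltonian formulations
    (∀ (m : ℕ) (J : Fin m → ℝ → Field p q → Field p q → Field p q)
      (H : Fin m → ℝ → Field p q → ℝ),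
      IsMultiHamiltonianFormulation I K J H → (∀ k, AdmitsScales r I (H k)) →
        IsMultiHamiltonianFormulation Set.univ
          (fun _ : ℝ => (perField K : BigField p q N r → BigField p q N r))
          (fun k (_ : ℝ) => perOperator (J k)) (fun k (_ : ℝ) => perFunctional (H k))) := by
  refine ⟨fun J H h hr => ⟨perFieldDefined hI h0 hK (h.field_zero hr),
    perOperatorDefined hI h0 h.operator.smooth, h.functional.perFunctionalDefined hI h0 hr,
    h.perturbation hI h0 hr⟩, fun J H₁ H₂ hJ h₁ h₂ hr₁ hr₂ =>
    ⟨h₁.perFunctionalDefined hI h0 hr₁, h₂.perFunctionalDefined hI h0 hr₂,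
    isFunctional_perFunctional hI h0 h₁ hr₁, isFunctional_perFunctional hI h0 h₂ hr₂,
    perOperatorDefined hI h0 hJ.smooth, isHamiltonianOp_perOperator hI h0 hJ,
    perFunctionalDefined_bracket hI h0 hJ.smooth h₁ h₂ hr₁ hr₂,
    bracket_perFunctional hI h0 hJ.smooth h₁ h₂ hr₁ hr₂⟩, fun m J H h hr =>
    ⟨fun k => (h.formulation k).perturbation hI h0 (hr k), fun k l c d => ?_⟩⟩
  have hcd := h.pair k l c d
  have heq := perOperator_comb (N := N) (r := r) hI h0 (h.formulation k).operator.smooth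
    (h.formulation l).operator.smooth c d hcd.smooth
  have hper := isHamiltonianOp_perOperator (N := N) (r := r) hI h0 hcd
  -- The combination is Hamiltonian before perturbation, hence after it; it remains to recognize its
  -- perturbation as the combination of the perturbed operators.
  have hfun : (perOperator (fun ε u α => c • J k ε u α + d • J l ε u α) :
      BigField p q N r → BigField p q N r → BigField p q N r)
      = fun η β => c • perOperator (J k) η β + d • perOperator (J l) η β := by
    funext η β
    exact heq η β
  rw [hfun] at hper
  exact hper
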